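/- **Setting.** Values are integers and capabilities $(k,st,end,off)$ with $k\in\{\kappa,\delta\}$ (code, data), authorizing access to the addresses $[st,end)$ and pointing to $st+off$; a memory is a partial map from integer addresses to values. Two imperative small-step languages have the commands $\mathtt{Assign}$, $\mathtt{Alloc}$, $\mathtt{Call}$, $\mathtt{Return}$, $\mathtt{JumpIfZero}$, $\mathtt{Exit}$; every memory access is through a data capability and checks its bounds, and the heap (of size at most $\nabla$) grows downwards from address $-1$. A (partial) program is a list of modules with located data and stack segments; linking $C[p]$ of a context $C$ and a program $p$ is concatenation. *Source language.* Expressions refer to module-global variables, arguments and local variables, whose addresses are data capabilities determined by a layout of the variables. A state $\langle Mem,\Phi,pc,stk,nalloc\rangle$ consists of memory, stack pointers of the module-local data stacks, program counter (function and position), control stack and next free address. *Target language.* There are no variables; expressions instead read the capability registers $ddc$ (data segment of the current module) and $stc$ (its stack), and code lies in a code memory. A state consists of memory, next free address, trusted control stack, the registers $ddc, stc, pcc$, and a map $mstc$ giving the stack capability of each module. *Compiler.* $[\![\cdot]\!]$ works module by module and command by command; relative to a layout $K$ that puts the functions at disjoint places of the code memory, it replaces $\&x$ by $\mathtt{limRange}$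 of $ddc$ (global $x$) or of $stc$ (argument or local $x$) to the bounds of $x$, and a variable or array access by the dereference of the translated address. *Traces.* Fix a whole program $C[p]$. Labels are $\tau$, $\checkmark$, and $\mathtt{ret}\,d\,Mem,nalloc$ and $\mathtt{call}(fid)\,\bar v\,d\,Mem,nalloc$ with a direction $d\in\{?,!\}$. A trace state $(s,\varsigma)$ is a state with the set $\varsigma$ of addresses shared so far. A step that does not transfer control between $p$ and $C$ has label $\tau$ and leaves $\varsigma$ unchanged; a terminal state (about to execute $\mathtt{Exit}$) has a $\checkmark$-loop; a call or return into $p$ ($?$) or out of $p$ ($!$) replaces $\varsigma$ by the set $\varsigma'$ of all addresses reachable in the new memory from $\varsigma$ and, for calls, from the arguments $\bar v$; its label records the new memory restricted to $\varsigma'$, the value of $nalloc$ and, for calls, the callee and $\bar v$. The compressed step $(s,\varsigma)\twoheadrightarrow^{\alpha}_p(s',\varsigma')$ says that there is a finite sequence of labeled steps from $(s,\varsigma)$ to $(s',\varsigma')$ whose list of non-$\tau$ labels is $\alpha$. Finally $Tr(p)=\{\alpha\mid\exists C,s,\varsigma.\ C[p]\text{ a well-formed whole program},\ (init(C[p]),\emptyset)\twoheadrightarrow^{\alpha}_p(s,\varsigma)\}$,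 in both languages. *Compiler-correctness relation.* For a well-formed whole source program $C[p]$ and a code layout $K$ of it, $s\cong t$, between states of $C[p]$ and of $[\![C[p]]\!]$, says: memories and next free addresses are equal; $pcc$ and $ddc$ are the capabilities that correspond to $pc$, and the control stacks correspond entry by entry in the same way; $mstc$ maps every module to the capability on its stack segment with offset $\Phi$ of the module, and $stc$ is its value at the current module; and $\Phi$ of every module is the total size of its frames of live calls, which fits in its stack segment. **Statement.** For every heap limit $\nabla$: 1. (Forward simulation) For every well-formed whole source program $C[p]$ and code layout $K$ of it, if $s\cong t$ and $(s,\varsigma)\twoheadrightarrow^{\alpha}_{p}(s',\varsigma')$ in $C[p]$, then there is $t'$ with $(t,\varsigma)\twoheadrightarrow^{\alpha}_{[\![p]\!]}(t',\varsigma')$ in $[\![C[p]]\!]$ and $s'\cong t'$. 2. (Backward simulation) For every such $C[p]$ and $K$, if $s\cong t$ and $(t,\varsigma)\twoheadrightarrow^{\alpha}_{[\![p]\!]}(t',\varsigma')$ in $[\![C[p]]\!]$, then there is $s'$ with $(s,\varsigma)\twoheadrightarrow^{\alpha}_{p}(s',\varsigma')$ in $C[p]$ and $s'\cong t'$. 3.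 (Initial states) For every well-formed whole source program $P$ and code layout $K$ of it, $[\![P]\!]$ is a well-formed whole target program, and initial states of $P$ and $[\![P]\!]$ exist that are related by $\cong$. 4. (No trace is omitted by compilation) For every source program $p$ and code layout $K$ of it, $Tr(p)\subseteq Tr([\![p]\!])$. -/

import Mathlib

namespace PAC

/-! ## Notions shared by the two languages -/

abbrev FunID := ℕ
abbrev ModID := ℕ
abbrev VarID := ℕ

/-- The name of the entry point. -/
def mainId : FunID := 0

/-- The kind of a capability: `code` is `κ`, `data` is `δ`. -/
inductive CapKind
  | code
  | data

/-- A capability `(kind, start, end, offset)`: it authorizes access to the addresses in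
`[start, end)`, and designates the address `start + offset`. -/
structure Cap where
  kind : CapKind
  start : ℤ
  upper : ℤ
  offset : ℤ

namespace Cap

def addr (c : Cap) : ℤ := c.start + c.offset

/-- The offset is within the bounds; this is checked only when the capability is used. -/
def InBounds (c : Cap) : Prop := c.start ≤ c.addr ∧ c.addr < c.upper

/-- Shift the offset. -/
def inc (c : Cap) (z : ℤ) : Cap := { c with offset := c.offset + z }

/-- The addresses to which a capability authorizes access. -/
def range (c : Cap) : Set ℤ := Set.Ico c.start c.upper

end Cap

/-- Run-time values: integers and capabilities. -/
inductive Val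
  | int (z : ℤ)
  | cap (c : Cap)

/-- A memory is a partial map from addresses to values. -/
abbrev Mem := ℤ → Option Val

/-- `M[a ↦ v]`. -/
def Mem.store (M : Mem) (a : ℤ) (v : Val) : Mem := Function.update M a (some v)

/-- Initialize the cells of `[lo, hi)` to zero. -/
def Mem.zero (M : Mem) (lo hi : ℤ) : Mem :=
  fun a => if lo ≤ a ∧ a < hi then some (.int 0) else M a

/-- Initialize a stack frame at `base`: first the arguments `vs`, then `nLocal` zeroed cells for
the local variables. -/
def Mem.pushFrame (M : Mem) (base : ℤ) (vs : List Val) (nLocal : ℕ) : Mem :=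
  fun a => if base ≤ a ∧ a < base + (vs.length + nLocal) then
    some (vs.getD (a - base).toNat (.int 0)) else M a

/-- The memory restricted to a set of addresses. -/
noncomputable def Mem.restrict (M : Mem) (A : Set ℤ) : Mem := by
  classical exact fun a => if a ∈ A then M a else none

/-- The initial memory: every cell of the given segments holds zero. -/
def initMem (segs : List (ℤ × ℤ)) : Mem :=
  fun a => if ∃ g ∈ segs, g.1 ≤ a ∧ a < g.2 then some (.int 0) else none

/-- The addresses reachable from the addresses in `A` through data capabilities stored in `M`
(the closure includes `A`). -/
inductive Reachable (A : Set ℤ) (M : Mem) : ℤ → Prop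
  | base {a : ℤ} : a ∈ A → Reachable A M a
  | step {a b : ℤ} {c : Cap} : Reachable A M a → M a = some (.cap c) → c.kind = .data →
      b ∈ c.range → Reachable A M b

def reachableClosure (A : Set ℤ) (M : Mem) : Set ℤ := {a | Reachable A M a}

/-- The addresses to which the values in the list directly give data access. -/
def argAddrs (vs : List Val) : Set ℤ :=
  {a | ∃ c : Cap, Val.cap c ∈ vs ∧ c.kind = .data ∧ a ∈ c.range}

/-- Binary arithmetic operators. -/
inductive BinOp
  | add
  | sub
  | mul

def BinOp.eval : BinOp → ℤ → ℤ → ℤ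
  | .add => (· + ·)
  | .sub => (· - ·)
  | .mul => (· * ·)

/-- The four getters on capabilities. -/
inductive Getter
  | start
  | upper
  | offset
  | capType

def Getter.eval : Getter → Cap → ℤ
  | .start, c => c.start
  | .upper, c => c.upper
  | .offset, c => c.offset
  | .capType, c => match c.kind with
    | .code => 0
    | .data => 1

/-- Commands, over a type `E` of expressions. -/
inductive Cmd (E : Type)
  | assign (l r : E)
  | alloc (l size : E)
  | call (fid : FunID) (args : List E)
  | ret
  | jumpIfZero (c off : E)
  | exit

def Cmd.map {E E' : Type} (g : E → E') : Cmd E → Cmd E'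
  | .assign l r => .assign (g l) (g r)
  | .alloc l size => .alloc (g l) (g size)
  | .call fid args => .call fid (args.map g)
  | .ret => .ret
  | .jumpIfZero c off => .jumpIfZero (g c) (g off)
  | .exit => .exit

/-- Segments of static memory lie at nonnegative addresses (the heap occupies the negative ones)
and do not overlap. -/
def SegmentsOK (segs : List (ℤ × ℤ)) : Prop :=
  (∀ g ∈ segs, 0 ≤ g.1 ∧ g.1 ≤ g.2) ∧
  segs.Pairwise fun g h => Disjoint (Set.Ico g.1 g.2) (Set.Ico h.1 h.2)

/-- A successful allocation of `n` cells: there is at least one cell, and the heap, which grows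
downwards from the address `-1`, keeps at most `limit` cells. -/
def AllocOK (limit : ℕ) (nalloc n : ℤ) : Prop := 0 < n ∧ -1 - (nalloc - n) ≤ limit

/-- The capability on a fresh block of `n` cells, the topmost of which is `nalloc`. -/
def freshCap (nalloc n : ℤ) : Cap := ⟨.data, nalloc - n + 1, nalloc + 1, 0⟩

/-- The memory after allocating `n` zeroed cells and storing a capability on them at `a`. -/
def Mem.alloc (M : Mem) (nalloc n a : ℤ) : Mem :=
  (M.zero (nalloc - n + 1) (nalloc + 1)).store a (.cap (freshCap nalloc n))

/-! ## Source language -/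

/-- Source expressions: integers, variables, `e ⊕ e`, `e[e]`, `&vid`, `&e[e]`, `*(e)`,
the getters, and `limRange(e, e, e)`. -/
inductive SExp
  | int (z : ℤ)
  | var (x : VarID)
  | bin (op : BinOp) (a b : SExp)
  | arr (a i : SExp)
  | addrVar (x : VarID)
  | addrArr (a i : SExp)
  | star (e : SExp)
  | get (g : Getter) (e : SExp)
  | limRange (e lo hi : SExp)

/-- The expression `&e`, which exists only if `e` is a variable or an array access. -/
def SExp.amp : SExp → Option SExp
  | .var x => some (.addrVar x)
  | .arr a i => some (.addrArr a i)
  | _ => none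

/-- A declared variable with its bounds `[lo, hi)`: the value of the layout `β`. For a module-global
variable they are relative to the start of the data segment of the module, for an argument or a local
variable to the stack pointer of the module while the function executes, which points to
the end of its frame. -/
structure VarDecl where
  id : VarID
  lo : ℤ
  hi : ℤ

def lookupVar (ds : List VarDecl) (x : VarID) : Option (ℤ × ℤ) :=
  (ds.find? fun d => d.id == x).map fun d => (d.lo, d.hi)

structure SFun where
  fid : FunID
  args : List VarDecl
  locals : List VarDecl
  /-- the number of memory cells of the local variables -/
  nLocal : ℕ
  body : List (Cmd SExp)

/-- Arguments take one cell each. -/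
def SFun.frameSize (f : SFun) : ℕ := f.args.length + f.nLocal

/-- A source module with its load-time information: its data segment `Δ` and the location `Σ` of
its local stack, both as half-open intervals of addresses. -/
structure SMod where
  mid : ModID
  data : ℤ × ℤ
  stack : ℤ × ℤ
  vars : List VarDecl
  funs : List SFun

/-- A (partial) source program is a list of modules. The linking of a context `C` and
a program `p` is `C ++ p`. -/
abbrev SProg := List SMod

namespace SProg

def HasFun (P : SProg) (m : SMod) (f : SFun) : Prop := m ∈ P ∧ f ∈ m.funs

def allFuns (P : SProg) : List SFun := P.flatMap SMod.funs

def segments (P : SProg) : List (ℤ × ℤ) := P.flatMap fun m => [m.data, m.stack]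

end SProg

/-- Variables in one scope have distinct names and disjoint places. -/
def ScopeOK (ds : List VarDecl) : Prop :=
  ds.Pairwise fun d d' => d.id ≠ d'.id ∧ Disjoint (Set.Ico d.lo d.hi) (Set.Ico d'.lo d'.hi)

structure SFun.WF (f : SFun) : Prop where
  body_ne : f.body ≠ []
  scope : ScopeOK (f.args ++ f.locals)
  /-- the arguments occupy the first cells of the frame -/
  args_place : ∀ (i : ℕ) (d : VarDecl), f.args[i]? = some d →
    d.lo = -(f.frameSize : ℤ) + i ∧ d.hi = d.lo + 1
  /-- the local variables occupy the remaining cells -/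
  locals_place : ∀ d ∈ f.locals, -(f.nLocal : ℤ) ≤ d.lo ∧ d.lo ≤ d.hi ∧ d.hi ≤ 0

structure SMod.WF (m : SMod) : Prop where
  scope : ScopeOK m.vars
  vars_place : ∀ d ∈ m.vars, 0 ≤ d.lo ∧ d.lo ≤ d.hi ∧ d.hi ≤ m.data.2 - m.data.1
  funs : ∀ f ∈ m.funs, f.WF

/-- A well-formed whole source program: names are unique, the static memory and the variables are
properly laid out, only functions of the program are called, and there is a `main` function, without
arguments, whose frame fits in the stack of its module. -/
structure SProg.Executable (P : SProg) : Prop where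
  mids : (P.map SMod.mid).Nodup
  fids : (P.allFuns.map SFun.fid).Nodup
  segs : SegmentsOK P.segments
  mods : ∀ m ∈ P, m.WF
  whole : ∀ f ∈ P.allFuns, ∀ fid es, Cmd.call fid es ∈ f.body → ∃ f' ∈ P.allFuns, f'.fid = fid
  main : ∃ m f, P.HasFun m f ∧ f.fid = mainId ∧ f.args = [] ∧
    (f.frameSize : ℤ) ≤ m.stack.2 - m.stack.1

/-- Evaluation of expressions in the function `f` of the module `m`, for the stack pointers `Φ`
and the memory `M`. -/
inductive SEval (m : SMod) (f : SFun) (Φ : ModID → ℤ) (M : Mem) : SExp → Val → Prop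
  | int (z : ℤ) : SEval m f Φ M (.int z) (.int z)
  | bin {op a b x y} : SEval m f Φ M a (.int x) → SEval m f Φ M b (.int y) →
      SEval m f Φ M (.bin op a b) (.int (op.eval x y))
  | addrLocal {x lo hi} : lookupVar (f.args ++ f.locals) x = some (lo, hi) →
      SEval m f Φ M (.addrVar x)
        (.cap ⟨.data, m.stack.1 + Φ m.mid + lo, m.stack.1 + Φ m.mid + hi, 0⟩)
  | addrModule {x lo hi} : lookupVar (f.args ++ f.locals) x = none →
      lookupVar m.vars x = some (lo, hi) →
      SEval m f Φ M (.addrVar x) (.cap ⟨.data, m.data.1 + lo, m.data.1 + hi, 0⟩)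
  | addrArr {a i a' c z} : a.amp = some a' → SEval m f Φ M a' (.cap c) → c.kind = .data →
      SEval m f Φ M i (.int z) → SEval m f Φ M (.addrArr a i) (.cap (c.inc z))
  | var {x c v} : SEval m f Φ M (.addrVar x) (.cap c) → c.kind = .data → c.InBounds →
      M c.addr = some v → SEval m f Φ M (.var x) v
  | arr {a i c v} : SEval m f Φ M (.addrArr a i) (.cap c) → c.kind = .data → c.InBounds →
      M c.addr = some v → SEval m f Φ M (.arr a i) v
  | star {e c v} : SEval m f Φ M e (.cap c) → c.kind = .data → c.InBounds →
      M c.addr = some v → SEval m f Φ M (.star e) v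
  | get {g e c} : SEval m f Φ M e (.cap c) → SEval m f Φ M (.get g e) (.int (g.eval c))
  | limRange {e elo ehi c lo hi} : SEval m f Φ M e (.cap c) → SEval m f Φ M elo (.int lo) →
      SEval m f Φ M ehi (.int hi) → Set.Ico lo hi ⊆ c.range →
      SEval m f Φ M (.limRange e elo ehi) (.cap ⟨c.kind, lo, hi, 0⟩)

/-- Source execution states: memory, stack pointers of the module-local stacks, program counter
(a function and a position in its body), control stack of return addresses, next free address. -/
structure SState where
  mem : Mem
  Φ : ModID → ℤ
  pc : FunID × ℤ
  stk : List (FunID × ℤ)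
  nalloc : ℤ

/-- In the state `s`, the function `f` of the module `m` executes and the next command is `c`. -/
structure SState.At (P : SProg) (s : SState) (m : SMod) (f : SFun) (c : Cmd SExp) : Prop where
  hasFun : P.HasFun m f
  fid : f.fid = s.pc.1
  nonneg : 0 ≤ s.pc.2
  cmd : f.body[s.pc.2.toNat]? = some c

abbrev SState.Eval (s : SState) (m : SMod) (f : SFun) : SExp → Val → Prop := SEval m f s.Φ s.mem

/-- Small-step semantics of the whole program `P` with heap size limit `limit`. -/
inductive SStep (P : SProg) (limit : ℕ) : SState → SState → Prop
  | assign {s : SState} {m f l r c v} : s.At P m f (.assign l r) →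
      s.Eval m f l (.cap c) → c.kind = .data → c.InBounds → s.Eval m f r v →
      SStep P limit s { s with mem := s.mem.store c.addr v, pc := (s.pc.1, s.pc.2 + 1) }
  | alloc {s : SState} {m f l e c n} : s.At P m f (.alloc l e) →
      s.Eval m f l (.cap c) → c.kind = .data → c.InBounds → s.Eval m f e (.int n) →
      AllocOK limit s.nalloc n →
      SStep P limit s { s with
        mem := s.mem.alloc s.nalloc n c.addr
        pc := (s.pc.1, s.pc.2 + 1)
        nalloc := s.nalloc - n }
  | call {s : SState} {m f fid es vs m' f'} : s.At P m f (.call fid es) →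
      List.Forall₂ (s.Eval m f) es vs →
      P.HasFun m' f' → f'.fid = fid → vs.length = f'.args.length →
      s.Φ m'.mid + f'.frameSize ≤ m'.stack.2 - m'.stack.1 →
      SStep P limit s { s with
        mem := s.mem.pushFrame (m'.stack.1 + s.Φ m'.mid) vs f'.nLocal
        Φ := Function.update s.Φ m'.mid (s.Φ m'.mid + f'.frameSize)
        pc := (fid, 0)
        stk := (s.pc.1, s.pc.2 + 1) :: s.stk }
  | ret {s : SState} {m f r stk'} : s.At P m f .ret → s.stk = r :: stk' →
      SStep P limit s { s with
        Φ := Function.update s.Φ m.mid (s.Φ m.mid - f.frameSize)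
        pc := r
        stk := stk' }
  | jumpZero {s : SState} {m f e eoff z} : s.At P m f (.jumpIfZero e eoff) →
      s.Eval m f e (.int 0) → s.Eval m f eoff (.int z) →
      SStep P limit s { s with pc := (s.pc.1, s.pc.2 + z) }
  | jumpNonzero {s : SState} {m f e eoff v} : s.At P m f (.jumpIfZero e eoff) →
      s.Eval m f e v → v ≠ .int 0 →
      SStep P limit s { s with pc := (s.pc.1, s.pc.2 + 1) }

/-- Terminal states are those about to execute `Exit`. -/
def SState.Terminal (P : SProg) (s : SState) : Prop := ∃ m f, s.At P m f .exit

/-- `s` is the initial state of the whole program `P`. -/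
def SInit (P : SProg) (s : SState) : Prop :=
  ∃ m f, P.HasFun m f ∧ f.fid = mainId ∧ s =
    { mem := initMem P.segments
      Φ := fun mid => if mid = m.mid then f.frameSize else 0
      pc := (mainId, 0)
      stk := []
      nalloc := -1 }

/-! ## Target language -/

/-- Target expressions. There is no expression that reads the program counter capability. -/
inductive TExp
  | int (z : ℤ)
  | getddc
  | getstc
  | bin (op : BinOp) (a b : TExp)
  | inc (a b : TExp)
  | deref (e : TExp)
  | get (g : Getter) (e : TExp)
  | limRange (e lo hi : TExp)

/-- A target function: its code is placed in the code memory from the address `start` on. -/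
structure TFun where
  fid : FunID
  start : ℤ
  nArgs : ℕ
  nLocal : ℕ
  body : List (Cmd TExp)

def TFun.frameSize (f : TFun) : ℕ := f.nArgs + f.nLocal

/-- The code capability on the function, pointing to its first command. -/
def TFun.codeCap (f : TFun) : Cap := ⟨.code, f.start, f.start + f.body.length, 0⟩

structure TMod where
  mid : ModID
  data : ℤ × ℤ
  stack : ℤ × ℤ
  funs : List TFun

/-- The data capability on the data segment of the module. -/
def TMod.dataCap (m : TMod) : Cap := ⟨.data, m.data.1, m.data.2, 0⟩

/-- A (partial) target program; the linking of `C` and `p` is `C ++ p`. -/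
abbrev TProg := List TMod

namespace TProg

def HasFun (P : TProg) (m : TMod) (f : TFun) : Prop := m ∈ P ∧ f ∈ m.funs

def allFuns (P : TProg) : List TFun := P.flatMap TMod.funs

def segments (P : TProg) : List (ℤ × ℤ) := P.flatMap fun m => [m.data, m.stack]

/-- The code memory of the program, a partial map from addresses to commands. -/
def codeMem (P : TProg) (a : ℤ) : Option (Cmd TExp) :=
  P.allFuns.findSome? fun f =>
    if f.start ≤ a then f.body[(a - f.start).toNat]? else none

def codeDom (P : TProg) : Set ℤ := {a | (P.codeMem a).isSome}

/-- `pcc` has the bounds of the code of the function `f` of the module `m`. -/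
def Owner (P : TProg) (pcc : Cap) (m : TMod) (f : TFun) : Prop :=
  P.HasFun m f ∧ pcc.start = f.codeCap.start ∧ pcc.upper = f.codeCap.upper

/-- A well-formed whole target program; compare `SProg.Executable`. -/
structure Executable (P : TProg) : Prop where
  mids : (P.map TMod.mid).Nodup
  fids : (P.allFuns.map TFun.fid).Nodup
  segs : SegmentsOK P.segments
  body_ne : ∀ f ∈ P.allFuns, f.body ≠ []
  code : P.allFuns.Pairwise fun f g => Disjoint f.codeCap.range g.codeCap.range
  whole : ∀ f ∈ P.allFuns, ∀ fid es, Cmd.call fid es ∈ f.body → ∃ f' ∈ P.allFuns, f'.fid = fid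
  main : ∃ m f, P.HasFun m f ∧ f.fid = mainId ∧ f.nArgs = 0 ∧
    (f.frameSize : ℤ) ≤ m.stack.2 - m.stack.1

end TProg

/-- Evaluation of target expressions, for the memory `M` and the registers `ddc` and `stc`. -/
inductive TEval (M : Mem) (ddc stc : Cap) : TExp → Val → Prop
  | int (z : ℤ) : TEval M ddc stc (.int z) (.int z)
  | ddc : TEval M ddc stc .getddc (.cap ddc)
  | stc : TEval M ddc stc .getstc (.cap stc)
  | bin {op a b x y} : TEval M ddc stc a (.int x) → TEval M ddc stc b (.int y) →
      TEval M ddc stc (.bin op a b) (.int (op.eval x y))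
  | inc {a b c z} : TEval M ddc stc a (.cap c) → TEval M ddc stc b (.int z) →
      TEval M ddc stc (.inc a b) (.cap (c.inc z))
  | deref {e c v} : TEval M ddc stc e (.cap c) → c.kind = .data → c.InBounds →
      M c.addr = some v → TEval M ddc stc (.deref e) v
  | get {g e c} : TEval M ddc stc e (.cap c) → TEval M ddc stc (.get g e) (.int (g.eval c))
  | limRange {e elo ehi c lo hi} : TEval M ddc stc e (.cap c) → TEval M ddc stc elo (.int lo) →
      TEval M ddc stc ehi (.int hi) → Set.Ico lo hi ⊆ c.range →
      TEval M ddc stc (.limRange e elo ehi) (.cap ⟨c.kind, lo, hi, 0⟩)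

/-- Target execution states. The trusted control stack holds, for every live call, the data
capability and the program counter capability to be restored upon return. -/
structure TState where
  mem : Mem
  nalloc : ℤ
  stk : List (Cap × Cap)
  ddc : Cap
  stc : Cap
  pcc : Cap
  mstc : ModID → Option Cap

/-- The next command in the state `s` is `c`. -/
structure TState.At (P : TProg) (s : TState) (c : Cmd TExp) : Prop where
  kind : s.pcc.kind = .code
  inBounds : s.pcc.InBounds
  cmd : P.codeMem s.pcc.addr = some c

abbrev TState.Eval (s : TState) : TExp → Val → Prop := TEval s.mem s.ddc s.stc

/-- Small-step semantics of the whole program `P` with heap size limit `limit`. -/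
inductive TStep (P : TProg) (limit : ℕ) : TState → TState → Prop
  | assign {s : TState} {l r c v} : s.At P (.assign l r) →
      s.Eval l (.cap c) → c.kind = .data → c.InBounds → s.Eval r v →
      TStep P limit s { s with mem := s.mem.store c.addr v, pcc := s.pcc.inc 1 }
  | alloc {s : TState} {l e c n} : s.At P (.alloc l e) →
      s.Eval l (.cap c) → c.kind = .data → c.InBounds → s.Eval e (.int n) →
      AllocOK limit s.nalloc n →
      TStep P limit s { s with
        mem := s.mem.alloc s.nalloc n c.addr
        pcc := s.pcc.inc 1
        nalloc := s.nalloc - n }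
  | call {s : TState} {fid es vs m' f' sc} : s.At P (.call fid es) →
      List.Forall₂ s.Eval es vs →
      P.HasFun m' f' → f'.fid = fid → vs.length = f'.nArgs →
      s.mstc m'.mid = some sc → sc.addr + f'.frameSize ≤ sc.upper →
      TStep P limit s { s with
        mem := s.mem.pushFrame sc.addr vs f'.nLocal
        stk := (s.ddc, s.pcc.inc 1) :: s.stk
        ddc := m'.dataCap
        stc := sc.inc f'.frameSize
        pcc := f'.codeCap
        mstc := Function.update s.mstc m'.mid (some (sc.inc f'.frameSize)) }
  | ret {s : TState} {m f ddc' pcc' stk' m' f' sc mstc' stc'} : s.At P .ret →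
      P.Owner s.pcc m f → s.stk = (ddc', pcc') :: stk' → P.Owner pcc' m' f' →
      s.mstc m.mid = some sc →
      mstc' = Function.update s.mstc m.mid (some (sc.inc (-(f.frameSize : ℤ)))) →
      mstc' m'.mid = some stc' →
      TStep P limit s { s with
        stk := stk'
        ddc := ddc'
        stc := stc'
        pcc := pcc'
        mstc := mstc' }
  | jumpZero {s : TState} {e eoff z} : s.At P (.jumpIfZero e eoff) →
      s.Eval e (.int 0) → s.Eval eoff (.int z) →
      TStep P limit s { s with pcc := s.pcc.inc z }
  | jumpNonzero {s : TState} {e eoff v} : s.At P (.jumpIfZero e eoff) →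
      s.Eval e v → v ≠ .int 0 →
      TStep P limit s { s with pcc := s.pcc.inc 1 }

def TState.Terminal (P : TProg) (s : TState) : Prop := s.At P .exit

/-- `s` is the initial state of the whole program `P`. -/
def TInit (P : TProg) (s : TState) : Prop :=
  ∃ m f, P.HasFun m f ∧ f.fid = mainId ∧ s =
    { mem := initMem P.segments
      nalloc := -1
      stk := []
      ddc := m.dataCap
      stc := ⟨.data, m.stack.1, m.stack.2, f.frameSize⟩
      pcc := f.codeCap
      mstc := fun mid => (P.find? fun m' => m'.mid == mid).map fun m' =>
        ⟨.data, m'.stack.1, m'.stack.2, if mid = m.mid then f.frameSize else 0⟩ }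

/-! ## The compiler -/

/-- The target expression for `&x` in the function `f` of the module `m`. A variable that is not in
scope has no value in the source, and is translated to an expression without value. -/
def transVar (m : SMod) (f : SFun) (x : VarID) : TExp :=
  match lookupVar (f.args ++ f.locals) x, lookupVar m.vars x with
  | some (lo, hi), _ =>
    let so := TExp.bin .add (.get .start .getstc) (.get .offset .getstc)
    .limRange .getstc (.bin .add (.int lo) so) (.bin .add (.int hi) so)
  | none, some (lo, hi) =>
    .limRange .getddc (.bin .add (.get .start .getddc) (.int lo))
      (.bin .add (.get .start .getddc) (.int hi))
  | none, none => .deref (.int 0)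

mutual

/-- The translation of expressions in the function `f` of the module `m`. -/
def transExp (m : SMod) (f : SFun) : SExp → TExp
  | .int z => .int z
  | .var x => .deref (transVar m f x)
  | .bin op a b => .bin op (transExp m f a) (transExp m f b)
  | .arr a i => .deref (.inc (transAddr m f a) (transExp m f i))
  | .addrVar x => transVar m f x
  | .addrArr a i => .inc (transAddr m f a) (transExp m f i)
  | .star e => .deref (transExp m f e)
  | .get g e => .get g (transExp m f e)
  | .limRange e lo hi => .limRange (transExp m f e) (transExp m f lo) (transExp m f hi)

/-- The translation of `&e`; where `&e` does not exist, an expression without value. -/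
def transAddr (m : SMod) (f : SFun) : SExp → TExp
  | .var x => transVar m f x
  | .arr a i => .inc (transAddr m f a) (transExp m f i)
  | _ => .deref (.int 0)

end

/-- The compilation of a function; `K` gives the places of functions in the code memory. -/
def compileFun (K : FunID → ℤ) (m : SMod) (f : SFun) : TFun where
  fid := f.fid
  start := K f.fid
  nArgs := f.args.length
  nLocal := f.nLocal
  body := f.body.map (Cmd.map (transExp m f))

def compileMod (K : FunID → ℤ) (m : SMod) : TMod where
  mid := m.mid
  data := m.data
  stack := m.stack
  funs := m.funs.map (compileFun K m)

/-- The compiler, which translates a program module by module. -/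
def compile (K : FunID → ℤ) (P : SProg) : TProg := P.map (compileMod K)

/-- The code layout `K` places the functions of `P` at disjoint ranges of addresses. -/
def CodeLayout (K : FunID → ℤ) (P : SProg) : Prop :=
  P.allFuns.Pairwise fun f g =>
    Disjoint (Set.Ico (K f.fid) (K f.fid + f.body.length))
      (Set.Ico (K g.fid) (K g.fid + g.body.length))

/-! ## Traces -/

/-- Directions of border crossings: `inp` (`?`) from the context to the program of interest,
`out` (`!`) from the program of interest to the context. -/
inductive Dir
  | inp
  | out

/-- Trace labels. -/
inductive Label
  | tau
  | tick
  | ret (d : Dir) (mem : Mem) (nalloc : ℤ)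
  | call (d : Dir) (fid : FunID) (vs : List Val) (mem : Mem) (nalloc : ℤ)

/-- Whether control crosses the border in the given direction, if `a` and `b` say that control is in
the program of interest before and after the step. -/
def Dir.Crosses : Dir → Prop → Prop → Prop
  | .inp, a, b => ¬a ∧ b
  | .out, a, b => a ∧ ¬b

/-- Control is in the part `p` of the source program. -/
def SState.Inside (p : SProg) (s : SState) : Prop := ∃ f ∈ p.allFuns, f.fid = s.pc.1

/-- Control is in the part `p` of the target program. -/
def TState.Inside (p : TProg) (s : TState) : Prop := s.pcc.range ⊆ p.codeDom

/-- Labeled trace steps of the whole source program `P` with the program part of interest `p`.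
Trace states carry the set of the addresses shared so far between `p` and the context. -/
inductive STrace (P : SProg) (limit : ℕ) (p : SProg) :
    SState × Set ℤ → Label → SState × Set ℤ → Prop
  | silent {s s' ς} : SStep P limit s s' → (s.Inside p ↔ s'.Inside p) →
      STrace P limit p (s, ς) .tau (s', ς)
  | tick {s ς} : s.Terminal P → STrace P limit p (s, ς) .tick (s, ς)
  | ret {d s s' ς ς' m f} : SStep P limit s s' → s.At P m f .ret →
      Dir.Crosses d (s.Inside p) (s'.Inside p) →
      ς' = reachableClosure ς s'.mem →
      STrace P limit p (s, ς) (.ret d (s'.mem.restrict ς') s.nalloc) (s', ς')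
  | call {d s s' ς ς' m f fid es vs} : SStep P limit s s' → s.At P m f (.call fid es) →
      Dir.Crosses d (s.Inside p) (s'.Inside p) → List.Forall₂ (s.Eval m f) es vs →
      ς' = reachableClosure (ς ∪ argAddrs vs) s'.mem →
      STrace P limit p (s, ς) (.call d fid vs (s'.mem.restrict ς') s.nalloc) (s', ς')

/-- Labeled trace steps of the whole target program `P` with the program part of interest `p`. -/
inductive TTrace (P : TProg) (limit : ℕ) (p : TProg) :
    TState × Set ℤ → Label → TState × Set ℤ → Prop
  | silent {s s' ς} : TStep P limit s s' → (s.Inside p ↔ s'.Inside p) →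
      TTrace P limit p (s, ς) .tau (s', ς)
  | tick {s ς} : s.Terminal P → TTrace P limit p (s, ς) .tick (s, ς)
  | ret {d s s' ς ς'} : TStep P limit s s' → s.At P .ret →
      Dir.Crosses d (s.Inside p) (s'.Inside p) →
      ς' = reachableClosure ς s'.mem →
      TTrace P limit p (s, ς) (.ret d (s'.mem.restrict ς') s.nalloc) (s', ς')
  | call {d s s' ς ς' fid es vs} : TStep P limit s s' → s.At P (.call fid es) →
      Dir.Crosses d (s.Inside p) (s'.Inside p) → List.Forall₂ s.Eval es vs →
      ς' = reachableClosure (ς ∪ argAddrs vs) s'.mem →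
      TTrace P limit p (s, ς) (.call d fid vs (s'.mem.restrict ς') s.nalloc) (s', ς')

/-- Compressed trace steps: a finite sequence of labeled steps, recorded by the list of
its labels other than `tau`. -/
inductive Compressed {S : Type} (R : S → Label → S → Prop) : S → List Label → S → Prop
  | nil (s : S) : Compressed R s [] s
  | tau {s s' s'' : S} {α : List Label} :
      R s .tau s' → Compressed R s' α s'' → Compressed R s α s''
  | cons {s s' s'' : S} {l : Label} {α : List Label} : l ≠ .tau →
      R s l s' → Compressed R s' α s'' → Compressed R s (l :: α) s''

/-- The traces of the partial source program `p`. -/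
def STr (limit : ℕ) (p : SProg) : Set (List Label) :=
  {α | ∃ (C : SProg) (s₀ s : SState) (ς : Set ℤ), SProg.Executable (C ++ p) ∧
    SInit (C ++ p) s₀ ∧ Compressed (STrace (C ++ p) limit p) (s₀, ∅) α (s, ς)}

/-- The traces of the partial target program `p`. -/
def TTr (limit : ℕ) (p : TProg) : Set (List Label) :=
  {α | ∃ (C : TProg) (s₀ s : TState) (ς : Set ℤ), TProg.Executable (C ++ p) ∧
    TInit (C ++ p) s₀ ∧ Compressed (TTrace (C ++ p) limit p) (s₀, ∅) α (s, ς)}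

/-! ## The compiler-correctness relation -/

/-- The size of the frame of the function `fid` if it belongs to the module `m`, and zero if not. -/
def SMod.frameOf (m : SMod) (fid : FunID) : ℕ :=
  ((m.funs.find? fun f => f.fid == fid).map SFun.frameSize).getD 0

/-- The stack pointer of every module is the total size of its frames of live calls, and these fit in
the stack of the module. -/
def SState.StacksOK (P : SProg) (s : SState) : Prop :=
  ∀ m ∈ P, s.Φ m.mid = (((s.pc.1 :: s.stk.map Prod.fst).map m.frameOf).sum : ℕ) ∧
    s.Φ m.mid ≤ m.stack.2 - m.stack.1

/-- The source program counter `pc` corresponds to the program counter capability `pcc` and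
the data capability `ddc` of the compiled program, where control is in the module `m`. -/
def PcRel (K : FunID → ℤ) (P : SProg) (m : SMod) (pc : FunID × ℤ) (ddc pcc : Cap) : Prop :=
  ∃ f, P.HasFun m f ∧ f.fid = pc.1 ∧
    ddc = (compileMod K m).dataCap ∧ pcc = (compileFun K m f).codeCap.inc pc.2

/-- The compiler-correctness relation between states of the whole source program `P` and states of
its compilation. -/
structure CrossRel (K : FunID → ℤ) (P : SProg) (s : SState) (t : TState) : Prop where
  mem : t.mem = s.mem
  nalloc : t.nalloc = s.nalloc
  control : ∃ m, PcRel K P m s.pc t.ddc t.pcc ∧ t.mstc m.mid = some t.stc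
  stk : List.Forall₂ (fun r e => ∃ m, PcRel K P m r e.1 e.2) s.stk t.stk
  mstc : ∀ m ∈ P, t.mstc m.mid = some ⟨.data, m.stack.1, m.stack.2, s.Φ m.mid⟩
  frames : s.StacksOK P

end PAC

/-!
The relation `CrossRel` is a lock-step bisimulation between a whole source program and its
compilation: every source step is matched by exactly one target step with the same label, and
conversely. Both directions rest on the following facts about related states.

* Evaluation agrees: `e` has the value `v` in the source if and only if its translation has the
  value `v` in the target (`teval_trans_iff`). The only place where the target checks more than
  the source is the `limRange` that replaces `&x`. This check always succeeds
  (`teval_transVar_iff`): global variables lie in the data segment, and arguments and local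
  variables lie in the current frame, which lies within the stack segment because the stack
  pointer is the total size of the live frames (`CrossRel.frame_le`).
* The next commands correspond (`ControlAt.at_iff`). Since the functions are placed at disjoint
  ranges, the code memory at an address inside a function is the translation of the body of that
  function (`codeMem_compile`), and, bodies being nonempty, the bounds of `pcc` determine the
  function and its module (`owner_compile_iff`), which is what a return of the target relies on.
* Control is inside the part `p` on one side if and only if it is on the other
  (`CrossRel.inside_iff`), again by disjointness, so border crossings and hence labels agree.

The relation itself is preserved by moves within a function (`CrossRel.update_local`), by calls
and by returns; the accounting of frames uses that a function belongs to a single module. Single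
labeled steps then lift to compressed steps by `Compressed.simulate`. Every initial state has a
related initial state (`SInit.exists_crossRel`). For the inclusion of traces, the layout of `p`
has to be extended to the context that exhibits the trace (`CodeLayout.exists_extension`), after
which forward simulation applies to the compilation of that context.
-/

namespace PAC

/-! ### Functions and their places in the code memory -/

theorem SProg.mem_allFuns {P : SProg} {f : SFun} : f ∈ P.allFuns ↔ ∃ m, P.HasFun m f := by
  simp [SProg.allFuns, SProg.HasFun]

theorem SProg.HasFun.mem_allFuns {P : SProg} {m : SMod} {f : SFun} (h : P.HasFun m f) :
    f ∈ P.allFuns := SProg.mem_allFuns.2 ⟨m, h⟩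

/-- Since function names are unique, a name determines the function and its module. -/
theorem SProg.Executable.hasFun_unique {P : SProg} (hP : P.Executable) {m m' : SMod} {f f' : SFun}
    (h : P.HasFun m f) (h' : P.HasFun m' f') (he : f.fid = f'.fid) : m = m' ∧ f = f' := by
  refine ⟨?_, List.inj_on_of_nodup_map hP.fids h.mem_allFuns h'.mem_allFuns he⟩
  have hn := hP.fids
  rw [SProg.allFuns, List.map_flatMap, List.nodup_flatMap] at hn
  by_contra hne
  have hs : Std.Symm (α := SMod)
      (Function.onFun List.Disjoint fun m => m.funs.map SFun.fid) :=
    ⟨fun _ _ hd => hd.symm⟩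
  have hd := hn.2.forall h.1 h'.1 hne
  exact hd (List.mem_map_of_mem h.2) (he ▸ List.mem_map_of_mem h'.2)

theorem SProg.Executable.mod_unique {P : SProg} (hP : P.Executable) {m m' : SMod}
    (h : m ∈ P) (h' : m' ∈ P) (he : m.mid = m'.mid) : m = m' :=
  List.inj_on_of_nodup_map hP.mids h h' he

theorem SProg.Executable.fun_wf {P : SProg} (hP : P.Executable) {m : SMod} {f : SFun}
    (h : P.HasFun m f) : f.WF := (hP.mods m h.1).funs f h.2

theorem SProg.Executable.body_pos {P : SProg} (hP : P.Executable) {m : SMod} {f : SFun}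
    (h : P.HasFun m f) : 0 < f.body.length := List.length_pos_of_ne_nil (hP.fun_wf h).body_ne

theorem SProg.Executable.frameOf_self {P : SProg} (hP : P.Executable) {m : SMod} {f : SFun}
    (h : P.HasFun m f) : m.frameOf f.fid = f.frameSize := by
  unfold SMod.frameOf
  cases hf : m.funs.find? fun g => g.fid == f.fid with
  | none => simpa using List.find?_eq_none.1 hf f h.2
  | some g =>
    have hg := List.find?_some hf
    obtain ⟨-, rfl⟩ := hP.hasFun_unique (m := m) (f := g) ⟨h.1, List.mem_of_find?_eq_some hf⟩ h
      (by simpa using hg)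
    rfl

theorem SProg.Executable.frameOf_of_ne {P : SProg} (hP : P.Executable) {m m' : SMod} {f : SFun}
    (h : P.HasFun m f) (h' : m' ∈ P) (hne : m' ≠ m) : m'.frameOf f.fid = 0 := by
  unfold SMod.frameOf
  cases hf : m'.funs.find? fun g => g.fid == f.fid with
  | none => rfl
  | some g =>
    have hg := List.find?_some hf
    exact absurd (hP.hasFun_unique (m := m') (f := g) ⟨h', List.mem_of_find?_eq_some hf⟩ h
      (by simpa using hg)).1 hne

/-- An address of the code memory belongs to at most one function. -/
theorem CodeLayout.unique {K : FunID → ℤ} {P : SProg} (hK : CodeLayout K P)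
    (hP : P.Executable) {m m' : SMod} {f f' : SFun} (h : P.HasFun m f) (h' : P.HasFun m' f') {a : ℤ}
    (ha : a ∈ Set.Ico (K f.fid) (K f.fid + f.body.length))
    (ha' : a ∈ Set.Ico (K f'.fid) (K f'.fid + f'.body.length)) : m = m' ∧ f = f' := by
  refine hP.hasFun_unique h h' ?_
  by_contra hne
  have hs : Std.Symm (α := SFun) (fun f g =>
      Disjoint (Set.Ico (K f.fid) (K f.fid + f.body.length))
        (Set.Ico (K g.fid) (K g.fid + g.body.length))) := ⟨fun _ _ hd => hd.symm⟩
  exact Set.disjoint_left.1 (List.Pairwise.forall hK h.mem_allFuns h'.mem_allFuns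
    fun e => hne (e ▸ rfl)) ha ha'

theorem hasFun_compile {K : FunID → ℤ} {P : SProg} {m' : TMod} {f' : TFun} :
    (compile K P).HasFun m' f' ↔
      ∃ m f, P.HasFun m f ∧ m' = compileMod K m ∧ f' = compileFun K m f := by
  constructor
  · rintro ⟨hm, hf⟩
    obtain ⟨m, hm₀, rfl⟩ := List.mem_map.1 hm
    obtain ⟨f, hf₀, rfl⟩ := List.mem_map.1 hf
    exact ⟨m, f, ⟨hm₀, hf₀⟩, rfl, rfl⟩
  · rintro ⟨m, f, ⟨hm, hf⟩, rfl, rfl⟩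
    exact ⟨List.mem_map_of_mem hm, List.mem_map_of_mem hf⟩

theorem mem_allFuns_compile {K : FunID → ℤ} {P : SProg} {f' : TFun} :
    f' ∈ (compile K P).allFuns ↔ ∃ m f, P.HasFun m f ∧ f' = compileFun K m f := by
  have : f' ∈ (compile K P).allFuns ↔ ∃ m', (compile K P).HasFun m' f' := by
    simp [TProg.allFuns, TProg.HasFun]
  rw [this]
  simp only [hasFun_compile]
  constructor
  · rintro ⟨_, m, f, h, -, e⟩
    exact ⟨m, f, h, e⟩
  · rintro ⟨m, f, h, e⟩
    exact ⟨_, m, f, h, rfl, e⟩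

theorem TProg.mem_range_of_codeMem {P : TProg} {a : ℤ} {c : Cmd TExp} (h : P.codeMem a = some c) :
    ∃ f ∈ P.allFuns, a ∈ Set.Ico f.start (f.start + f.body.length) ∧
      f.body[(a - f.start).toNat]? = some c := by
  obtain ⟨f, hf, hc⟩ := List.exists_of_findSome?_eq_some h
  split at hc
  · obtain ⟨hl, -⟩ := List.getElem?_eq_some_iff.1 hc
    exact ⟨f, hf, ⟨by assumption, by omega⟩, hc⟩
  · cases hc

theorem TProg.codeMem_isSome {P : TProg} {f : TFun} (hf : f ∈ P.allFuns) {a : ℤ}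
    (ha : a ∈ Set.Ico f.start (f.start + f.body.length)) : (P.codeMem a).isSome := by
  refine List.findSome?_isSome_iff.2 ⟨f, hf, ?_⟩
  obtain ⟨h₁, h₂⟩ := ha
  rw [if_pos h₁, List.getElem?_eq_getElem (by omega)]
  rfl

theorem codeMem_compile {K : FunID → ℤ} {P : SProg} (hP : P.Executable) (hK : CodeLayout K P)
    {m : SMod} {f : SFun} (h : P.HasFun m f) {i : ℤ} (h₀ : 0 ≤ i) (h₁ : i < f.body.length) :
    (compile K P).codeMem (K f.fid + i) =
      f.body[i.toNat]?.map (Cmd.map (transExp m f)) := by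
  have hs := TProg.codeMem_isSome (P := compile K P) (f := compileFun K m f)
    (mem_allFuns_compile.2 ⟨m, f, h, rfl⟩) (a := K f.fid + i)
    (by simp [compileFun]; omega)
  obtain ⟨c, hc⟩ := Option.isSome_iff_exists.1 hs
  obtain ⟨g, hg, ha, hgc⟩ := TProg.mem_range_of_codeMem hc
  obtain ⟨m', f', h', rfl⟩ := mem_allFuns_compile.1 hg
  obtain ⟨rfl, rfl⟩ := hK.unique hP h h' (a := K f.fid + i) ⟨by omega, by omega⟩
    (by simpa [compileFun] using ha)
  rw [hc, ← hgc]
  simp [compileFun]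

/-- The bounds of a program counter capability determine the function and its module. -/
theorem owner_compile_iff {K : FunID → ℤ} {P : SProg} (hP : P.Executable) (hK : CodeLayout K P)
    {m : SMod} {f : SFun} (h : P.HasFun m f) {z : ℤ} {m' : TMod} {f' : TFun} :
    (compile K P).Owner ((compileFun K m f).codeCap.inc z) m' f' ↔
      m' = compileMod K m ∧ f' = compileFun K m f := by
  constructor
  · rintro ⟨hf, hs, hu⟩
    obtain ⟨m₁, f₁, h₁, rfl, rfl⟩ := hasFun_compile.1 hf
    simp only [Cap.inc, TFun.codeCap, compileFun, List.length_map] at hs hu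
    have hb := hP.body_pos h
    obtain ⟨rfl, rfl⟩ := hK.unique hP h h₁ (a := K f.fid) ⟨le_rfl, by omega⟩ ⟨by omega, by omega⟩
    exact ⟨rfl, rfl⟩
  · rintro ⟨rfl, rfl⟩
    exact ⟨hasFun_compile.2 ⟨m, f, h, rfl, rfl⟩, rfl, rfl⟩

/-! ### Evaluation of translated expressions -/

theorem lookupVar_mem {ds : List VarDecl} {x : VarID} {lo hi : ℤ}
    (h : lookupVar ds x = some (lo, hi)) : ∃ d ∈ ds, d.lo = lo ∧ d.hi = hi := by
  simp only [lookupVar, Option.map_eq_some_iff, Prod.mk.injEq] at h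
  obtain ⟨d, hd, h⟩ := h
  exact ⟨d, List.mem_of_find?_eq_some hd, h⟩

/-- Arguments and local variables are placed inside the frame. -/
theorem SFun.WF.lookup_bounds {f : SFun} (hf : f.WF) {x : VarID} {lo hi : ℤ}
    (h : lookupVar (f.args ++ f.locals) x = some (lo, hi)) : -(f.frameSize : ℤ) ≤ lo ∧ hi ≤ 0 := by
  obtain ⟨d, hd, rfl, rfl⟩ := lookupVar_mem h
  have hs : f.frameSize = f.args.length + f.nLocal := rfl
  rcases List.mem_append.1 hd with hd | hd
  · obtain ⟨i, hi⟩ := List.mem_iff_getElem?.1 hd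
    obtain ⟨hl, -⟩ := List.getElem?_eq_some_iff.1 hi
    have := hf.args_place i d hi
    omega
  · have := hf.locals_place d hd
    omega

/-- The capability on the stack segment of the module `m`, with its stack pointer as offset. -/
def SMod.stackCap (m : SMod) (Φ : ModID → ℤ) : Cap := ⟨.data, m.stack.1, m.stack.2, Φ m.mid⟩

/-- The capability on the data segment of the module `m`. -/
def SMod.dataCap (m : SMod) : Cap := ⟨.data, m.data.1, m.data.2, 0⟩

section Eval

variable {m : SMod} {f : SFun} {Φ : ModID → ℤ} {M : Mem}

theorem SEval.data_of_addrVar {x : VarID} {v : Val} (h : SEval m f Φ M (.addrVar x) v) :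
    ∃ c : Cap, v = .cap c ∧ c.kind = .data := by
  cases h <;> exact ⟨_, rfl, rfl⟩

theorem SEval.data_of_addrArr {a i : SExp} {v : Val} (h : SEval m f Φ M (.addrArr a i) v) :
    ∃ c : Cap, v = .cap c ∧ c.kind = .data := by
  cases h with
  | addrArr _ _ hk _ => exact ⟨_, rfl, hk⟩

theorem SEval.data_of_amp {a a' : SExp} (ha : a.amp = some a') {v : Val}
    (h : SEval m f Φ M a' v) : ∃ c : Cap, v = .cap c ∧ c.kind = .data := by
  cases a <;> simp only [SExp.amp, Option.some.injEq, reduceCtorEq] at ha <;> subst ha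
  · exact h.data_of_addrVar
  · exact h.data_of_addrArr

theorem not_teval_deref_int {ddc stc : Cap} {z : ℤ} {v : Val} :
    ¬TEval M ddc stc (.deref (.int z)) v := by
  intro h
  cases h with
  | deref h => cases h

/-- The bounds check of `limRange` never fails on a translated variable: the variable lies within
the data segment, or within the current frame, which lies within the stack segment. -/
theorem teval_transVar_iff (hm : m.WF) (hf : f.WF) (h₀ : (f.frameSize : ℤ) ≤ Φ m.mid)
    (h₁ : Φ m.mid ≤ m.stack.2 - m.stack.1) {x : VarID} {v : Val} :
    TEval M m.dataCap (m.stackCap Φ) (transVar m f x) v ↔ SEval m f Φ M (.addrVar x) v := by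
  unfold transVar
  cases hl : lookupVar (f.args ++ f.locals) x with
  | some b =>
    obtain ⟨lo, hi⟩ := b
    have hb := hf.lookup_bounds hl
    have key : SEval m f Φ M (.addrVar x)
        (.cap ⟨.data, m.stack.1 + Φ m.mid + lo, m.stack.1 + Φ m.mid + hi, 0⟩) := .addrLocal hl
    constructor
    · intro h
      cases h with
      | limRange hc hlo hhi hr =>
        cases hc
        cases hlo with
        | bin ha hb =>
        cases ha
        cases hb with
        | bin ha hb =>
        cases ha with
        | get ha =>
        cases ha
        cases hb with
        | get hb =>
        cases hb
        cases hhi with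
        | bin ha hb =>
        cases ha
        cases hb with
        | bin ha hb =>
        cases ha with
        | get ha =>
        cases ha
        cases hb with
        | get hb =>
        cases hb
        simpa [BinOp.eval, Getter.eval, SMod.stackCap, add_comm] using key
    · intro h
      have hv : v = .cap ⟨.data, lo + (m.stack.1 + Φ m.mid), hi + (m.stack.1 + Φ m.mid), 0⟩ := by
        cases h with
        | addrLocal h' =>
          rw [hl] at h'
          cases h'
          simp [add_comm]
        | addrModule h' => rw [hl] at h'; cases h'
      rw [hv]
      have ho : ∀ z : ℤ, TEval M m.dataCap (m.stackCap Φ)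
          (.bin .add (.int z) (.bin .add (.get .start .getstc) (.get .offset .getstc)))
          (.int (z + (m.stack.1 + Φ m.mid))) :=
        fun z => .bin (op := .add) (.int z)
          (.bin (op := .add) (.get (g := .start) .stc) (.get (g := .offset) .stc))
      refine .limRange .stc (ho lo) (ho hi) (Set.Ico_subset_Ico ?_ ?_) <;>
        simp only [SMod.stackCap] <;> omega
  | none =>
    cases hg : lookupVar m.vars x with
    | some b =>
      obtain ⟨lo, hi⟩ := b
      have hb : 0 ≤ lo ∧ hi ≤ m.data.2 - m.data.1 := by
        obtain ⟨d, hd, rfl, rfl⟩ := lookupVar_mem hg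
        have := hm.vars_place d hd
        exact ⟨this.1, this.2.2⟩
      have key : SEval m f Φ M (.addrVar x)
          (.cap ⟨.data, m.data.1 + lo, m.data.1 + hi, 0⟩) := .addrModule hl hg
      constructor
      · intro h
        cases h with
        | limRange hc hlo hhi hr =>
          cases hc
          cases hlo with
          | bin ha hb =>
          cases hb
          cases ha with
          | get ha =>
          cases ha
          cases hhi with
          | bin ha hb =>
          cases hb
          cases ha with
          | get ha =>
          cases ha
          exact key
      · intro h
        have hv : v = .cap ⟨.data, m.data.1 + lo, m.data.1 + hi, 0⟩ := by
          cases h with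
          | addrLocal h' => rw [hl] at h'; cases h'
          | addrModule _ h' => rw [hg] at h'; cases h'; rfl
        rw [hv]
        have ho : ∀ z : ℤ, TEval M m.dataCap (m.stackCap Φ)
            (.bin .add (.get .start .getddc) (.int z)) (.int (m.data.1 + z)) :=
          fun z => .bin (op := .add) (.get (g := .start) .ddc) (.int z)
        refine .limRange .ddc (ho lo) (ho hi) (Set.Ico_subset_Ico ?_ ?_) <;>
          simp only [SMod.dataCap] <;> omega
    | none =>
      refine iff_of_false not_teval_deref_int ?_
      intro h
      cases h with
      | addrLocal h' => rw [hl] at h'; cases h'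
      | addrModule _ h' => rw [hg] at h'; cases h'

/-- Joint induction for an expression `e` and for `&e`. The source requires a data capability in an
array access where the target does not, but `&e` only has such values (`SEval.data_of_amp`). -/
theorem teval_trans_iff (hm : m.WF) (hf : f.WF) (h₀ : (f.frameSize : ℤ) ≤ Φ m.mid)
    (h₁ : Φ m.mid ≤ m.stack.2 - m.stack.1) (e : SExp) :
    (∀ v, TEval M m.dataCap (m.stackCap Φ) (transExp m f e) v ↔ SEval m f Φ M e v) ∧
    (∀ v, TEval M m.dataCap (m.stackCap Φ) (transAddr m f e) v ↔
      ∃ e', e.amp = some e' ∧ SEval m f Φ M e' v) := by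
  have hx := fun x v => teval_transVar_iff (M := M) hm hf h₀ h₁ (x := x) (v := v)
  have hinc : ∀ a i, (∀ v, TEval M m.dataCap (m.stackCap Φ) (transExp m f i) v ↔
        SEval m f Φ M i v) →
      (∀ v, TEval M m.dataCap (m.stackCap Φ) (transAddr m f a) v ↔
        ∃ a', a.amp = some a' ∧ SEval m f Φ M a' v) →
      ∀ v, TEval M m.dataCap (m.stackCap Φ) (.inc (transAddr m f a) (transExp m f i)) v ↔
        SEval m f Φ M (.addrArr a i) v := by
    intro a i hi ha v
    constructor
    · intro h
      cases h with
      | inc h₁ h₂ =>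
        obtain ⟨a', hamp, h'⟩ := (ha _).1 h₁
        obtain ⟨c, hc, hk⟩ := SEval.data_of_amp hamp h'
        cases hc
        exact .addrArr hamp h' hk ((hi _).1 h₂)
    · intro h
      cases h with
      | addrArr hamp h' hk h₂ => exact .inc ((ha _).2 ⟨_, hamp, h'⟩) ((hi _).2 h₂)
  have hno : ∀ e : SExp, e.amp = none → transAddr m f e = .deref (.int 0) →
      ∀ v, TEval M m.dataCap (m.stackCap Φ) (transAddr m f e) v ↔
        ∃ e', e.amp = some e' ∧ SEval m f Φ M e' v := by
    intro e h ht v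
    rw [ht, h]
    exact iff_of_false not_teval_deref_int (by simp)
  induction e with
  | int z =>
    refine ⟨fun v => ?_, hno _ rfl (by simp [transAddr])⟩
    rw [transExp]
    constructor <;> intro h <;> cases h <;> constructor
  | var x =>
    refine ⟨fun v => ?_, fun v => ?_⟩
    · rw [transExp]
      constructor <;> intro h
      · cases h with
        | deref h hk hb hM => exact .var ((hx _ _).1 h) hk hb hM
      · cases h with
        | var h hk hb hM => exact .deref ((hx _ _).2 h) hk hb hM
    · rw [transAddr, hx]
      simp [SExp.amp]
  | bin op a b iha ihb =>
    refine ⟨fun v => ?_, hno _ rfl (by simp [transAddr])⟩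
    rw [transExp]
    constructor <;> intro h
    · cases h with
      | bin h h' => exact .bin ((iha.1 _).1 h) ((ihb.1 _).1 h')
    · cases h with
      | bin h h' => exact .bin ((iha.1 _).2 h) ((ihb.1 _).2 h')
  | arr a i iha ihi =>
    refine ⟨fun v => ?_, fun v => ?_⟩
    · rw [transExp]
      constructor <;> intro h
      · cases h with
        | deref h hk hb hM => exact .arr ((hinc a i ihi.1 iha.2 _).1 h) hk hb hM
      · cases h with
        | arr h hk hb hM => exact .deref ((hinc a i ihi.1 iha.2 _).2 h) hk hb hM
    · rw [transAddr, hinc a i ihi.1 iha.2]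
      simp [SExp.amp]
  | addrVar x =>
    refine ⟨fun v => ?_, hno _ rfl (by simp [transAddr])⟩
    rw [transExp, hx]
  | addrArr a i iha ihi =>
    refine ⟨fun v => ?_, hno _ rfl (by simp [transAddr])⟩
    rw [transExp, hinc a i ihi.1 iha.2]
  | star e ih =>
    refine ⟨fun v => ?_, hno _ rfl (by simp [transAddr])⟩
    rw [transExp]
    constructor <;> intro h
    · cases h with
      | deref h hk hb hM => exact .star ((ih.1 _).1 h) hk hb hM
    · cases h with
      | star h hk hb hM => exact .deref ((ih.1 _).2 h) hk hb hM
  | get g e ih =>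
    refine ⟨fun v => ?_, hno _ rfl (by simp [transAddr])⟩
    rw [transExp]
    constructor <;> intro h
    · cases h with
      | get h => exact .get ((ih.1 _).1 h)
    · cases h with
      | get h => exact .get ((ih.1 _).2 h)
  | limRange e lo hi ihe ihlo ihhi =>
    refine ⟨fun v => ?_, hno _ rfl (by simp [transAddr])⟩
    rw [transExp]
    constructor <;> intro h
    · cases h with
      | limRange h hl hh hr => exact .limRange ((ihe.1 _).1 h) ((ihlo.1 _).1 hl) ((ihhi.1 _).1 hh) hr
    · cases h with
      | limRange h hl hh hr => exact .limRange ((ihe.1 _).2 h) ((ihlo.1 _).2 hl) ((ihhi.1 _).2 hh) hr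

end Eval

/-! ### Related states -/

section States

variable {K : FunID → ℤ} {P : SProg} {s : SState} {t : TState} {m : SMod} {f : SFun}

/-- Control in related states is in the function `f` of the module `m`, at corresponding positions,
and the registers `ddc` and `stc` of the target state belong to `m`. -/
structure ControlAt (K : FunID → ℤ) (P : SProg) (s : SState) (t : TState) (m : SMod) (f : SFun) :
    Prop where
  hasFun : P.HasFun m f
  fid : f.fid = s.pc.1
  ddc : t.ddc = m.dataCap
  stc : t.stc = m.stackCap s.Φ
  pcc : t.pcc = (compileFun K m f).codeCap.inc s.pc.2

theorem CrossRel.exists_controlAt (h : CrossRel K P s t) : ∃ m f, ControlAt K P s t m f := by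
  obtain ⟨m, ⟨f, hf, hfid, hddc, hpcc⟩, hstc⟩ := h.control
  refine ⟨m, f, hf, hfid, hddc, ?_, hpcc⟩
  have := h.mstc m hf.1
  rw [hstc] at this
  exact Option.some_injective _ this

/-- In related states, the frame of the current function is on the stack of its module. -/
theorem CrossRel.frame_le (hP : P.Executable) (h : CrossRel K P s t) (hc : ControlAt K P s t m f) :
    (f.frameSize : ℤ) ≤ s.Φ m.mid ∧ s.Φ m.mid ≤ m.stack.2 - m.stack.1 := by
  obtain ⟨h₁, h₂⟩ := h.frames m hc.hasFun.1
  refine ⟨?_, h₂⟩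
  rw [h₁, List.map_cons, List.sum_cons, ← hc.fid, hP.frameOf_self hc.hasFun]
  exact_mod_cast Nat.le_add_right _ _

theorem CrossRel.eval_iff (hP : P.Executable) (h : CrossRel K P s t) (hc : ControlAt K P s t m f)
    (e : SExp) (v : Val) : t.Eval (transExp m f e) v ↔ s.Eval m f e v := by
  obtain ⟨h₀, h₁⟩ := h.frame_le hP hc
  rw [TState.Eval, hc.ddc, hc.stc, h.mem]
  exact (teval_trans_iff (hP.mods m hc.hasFun.1) (hP.fun_wf hc.hasFun) h₀ h₁ e).1 v

theorem CrossRel.eval_list_iff (hP : P.Executable) (h : CrossRel K P s t)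
    (hc : ControlAt K P s t m f) (es : List SExp) (vs : List Val) :
    List.Forall₂ t.Eval (es.map (transExp m f)) vs ↔ List.Forall₂ (s.Eval m f) es vs := by
  rw [List.forall₂_map_left_iff]
  have : (fun e v => t.Eval (transExp m f e) v) = s.Eval m f := by
    funext e v
    exact propext (h.eval_iff hP hc e v)
  rw [this]

theorem ControlAt.eq_of_at (hP : P.Executable) (hc : ControlAt K P s t m f) {m' : SMod} {f' : SFun}
    {c : Cmd SExp} (ha : s.At P m' f' c) : m' = m ∧ f' = f :=
  hP.hasFun_unique ha.hasFun hc.hasFun (ha.fid.trans hc.fid.symm)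

/-- Related states are about to execute corresponding commands. In particular a jump out of the body
of a function leaves both states without a command: the bounds of `pcc` are those of the body. -/
theorem ControlAt.at_iff (hP : P.Executable) (hK : CodeLayout K P)
    (hc : ControlAt K P s t m f) {c' : Cmd TExp} :
    t.At (compile K P) c' ↔ ∃ c, s.At P m f c ∧ c' = c.map (transExp m f) := by
  have haddr : t.pcc.addr = K f.fid + s.pc.2 := by
    rw [hc.pcc]
    simp [Cap.addr, Cap.inc, TFun.codeCap, compileFun]
  have hbd : t.pcc.InBounds ↔ 0 ≤ s.pc.2 ∧ s.pc.2 < f.body.length := by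
    rw [Cap.InBounds, haddr, hc.pcc]
    simp [Cap.inc, TFun.codeCap, compileFun]
  constructor
  · rintro ⟨-, hb, hcmd⟩
    obtain ⟨h₀, h₁⟩ := hbd.1 hb
    rw [haddr, codeMem_compile hP hK hc.hasFun h₀ h₁, Option.map_eq_some_iff] at hcmd
    obtain ⟨c, h, rfl⟩ := hcmd
    exact ⟨c, ⟨hc.hasFun, hc.fid, h₀, h⟩, rfl⟩
  · rintro ⟨c, ⟨-, -, h₀, h⟩, rfl⟩
    obtain ⟨hl, -⟩ := List.getElem?_eq_some_iff.1 h
    have h₁ : s.pc.2 < f.body.length := by omega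
    refine ⟨by rw [hc.pcc]; rfl, hbd.2 ⟨h₀, h₁⟩, ?_⟩
    rw [haddr, codeMem_compile hP hK hc.hasFun h₀ h₁, h]
    rfl

/-! ### Preservation of the relation -/

theorem Cap.inc_inc (c : Cap) (y z : ℤ) : (c.inc y).inc z = c.inc (y + z) := by
  simp [Cap.inc, add_assoc]

/-- The relation is preserved by changes of memory and by jumps inside the current function. -/
theorem CrossRel.update_local (h : CrossRel K P s t) {M M' : Mem} {n n' : ℤ} (hM : M' = M)
    (hn : n' = n) (z : ℤ) :
    CrossRel K P { s with mem := M, pc := (s.pc.1, s.pc.2 + z), nalloc := n }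
      { t with mem := M', pcc := t.pcc.inc z, nalloc := n' } := by
  obtain ⟨m, ⟨f, hf, hfid, hddc, hpcc⟩, hstc⟩ := h.control
  refine ⟨hM, hn, ⟨m, ⟨f, hf, hfid, hddc, ?_⟩, hstc⟩, h.stk, h.mstc, h.frames⟩
  show t.pcc.inc z = _
  rw [hpcc, Cap.inc_inc]

/-- A call pushes a frame on the stack of the module `m'` of the callee, and on no other stack. -/
theorem CrossRel.call (hP : P.Executable) (h : CrossRel K P s t) {m' : SMod} {f' : SFun}
    (hf' : P.HasFun m' f') (hfit : s.Φ m'.mid + f'.frameSize ≤ m'.stack.2 - m'.stack.1) (M : Mem) :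
    CrossRel K P
      { s with
        mem := M
        Φ := Function.update s.Φ m'.mid (s.Φ m'.mid + f'.frameSize)
        pc := (f'.fid, 0)
        stk := (s.pc.1, s.pc.2 + 1) :: s.stk }
      { t with
        mem := M
        stk := (t.ddc, t.pcc.inc 1) :: t.stk
        ddc := m'.dataCap
        stc := (m'.stackCap s.Φ).inc f'.frameSize
        pcc := (compileFun K m' f').codeCap
        mstc := Function.update t.mstc m'.mid (some ((m'.stackCap s.Φ).inc f'.frameSize)) } := by
  obtain ⟨m, ⟨f, hf, hfid, hddc, hpcc⟩, hstc⟩ := h.control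
  refine ⟨rfl, h.nalloc, ⟨m', ⟨f', hf', rfl, rfl, rfl⟩, by simp⟩, ?_, ?_, ?_⟩
  · exact .cons ⟨m, f, hf, hfid, hddc, by rw [hpcc, Cap.inc_inc]⟩ h.stk
  · intro m₁ hm₁
    by_cases he : m₁ = m'
    · subst he
      simp [SMod.stackCap, Cap.inc]
    · have hne : m₁.mid ≠ m'.mid := fun e => he (hP.mod_unique hm₁ hf'.1 e)
      simpa [hne] using h.mstc m₁ hm₁
  · intro m₁ hm₁
    obtain ⟨h₁, h₂⟩ := h.frames m₁ hm₁
    simp only [List.map_cons, List.sum_cons] at h₁ ⊢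
    by_cases he : m₁ = m'
    · subst he
      rw [Function.update_self, hP.frameOf_self hf', h₁]
      refine ⟨by push_cast; ring, ?_⟩
      rw [h₁] at hfit
      exact hfit
    · have hne : m₁.mid ≠ m'.mid := fun e => he (hP.mod_unique hm₁ hf'.1 e)
      rw [Function.update_of_ne hne, hP.frameOf_of_ne hf' hm₁ he, zero_add]
      exact ⟨h₁, h₂⟩

/-- Returning pops the frame of the current function from the stack of its module `m`. The register
`stc` is read from `mstc` after this update, so that the case of a return within `m` is included. -/
theorem CrossRel.ret (hP : P.Executable) (h : CrossRel K P s t) (hc : ControlAt K P s t m f)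
    {r : FunID × ℤ} {stk' : List (FunID × ℤ)} (hs : s.stk = r :: stk') {ddc' pcc' stc' : Cap}
    {tstk' : List (Cap × Cap)} (ht : t.stk = (ddc', pcc') :: tstk') {m' : SMod}
    (hr : PcRel K P m' r ddc' pcc')
    (hstc : Function.update t.mstc m.mid (some ((m.stackCap s.Φ).inc (-(f.frameSize : ℤ)))) m'.mid =
      some stc') :
    CrossRel K P
      { s with
        Φ := Function.update s.Φ m.mid (s.Φ m.mid - f.frameSize)
        pc := r
        stk := stk' }
      { t with
        stk := tstk'
        ddc := ddc'
        stc := stc'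
        pcc := pcc'
        mstc := Function.update t.mstc m.mid
          (some ((m.stackCap s.Φ).inc (-(f.frameSize : ℤ)))) } := by
  have hstk := h.stk
  rw [hs, ht, List.forall₂_cons] at hstk
  refine ⟨h.mem, h.nalloc, ⟨m', hr, hstc⟩, hstk.2, ?_, ?_⟩
  · intro m₁ hm₁
    by_cases he : m₁ = m
    · subst he
      simp [SMod.stackCap, Cap.inc, sub_eq_add_neg]
    · have hne : m₁.mid ≠ m.mid := fun e => he (hP.mod_unique hm₁ hc.hasFun.1 e)
      simpa [hne] using h.mstc m₁ hm₁
  · intro m₁ hm₁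
    obtain ⟨h₁, h₂⟩ := h.frames m₁ hm₁
    rw [hs] at h₁
    simp only [List.map_cons, List.sum_cons] at h₁ ⊢
    rw [← hc.fid] at h₁
    by_cases he : m₁ = m
    · subst he
      rw [Function.update_self]
      rw [hP.frameOf_self hc.hasFun] at h₁
      refine ⟨by rw [h₁]; push_cast; ring, by omega⟩
    · have hne : m₁.mid ≠ m.mid := fun e => he (hP.mod_unique hm₁ hc.hasFun.1 e)
      rw [hP.frameOf_of_ne hc.hasFun hm₁ he, zero_add] at h₁
      rw [Function.update_of_ne hne]
      exact ⟨h₁, h₂⟩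

/-! ### Simulation of single steps -/

variable {limit : ℕ}

theorem CrossRel.step_forward (hP : P.Executable) (hK : CodeLayout K P) (h : CrossRel K P s t)
    {s' : SState} (hs : SStep P limit s s') :
    ∃ t', TStep (compile K P) limit t t' ∧ CrossRel K P s' t' := by
  obtain ⟨m, f, hc⟩ := h.exists_controlAt
  have ev := fun e v => (h.eval_iff hP hc e v).2
  cases hs with
  | assign ha hl hk hb hr =>
    obtain ⟨rfl, rfl⟩ := hc.eq_of_at hP ha
    refine ⟨_, .assign ((hc.at_iff hP hK).2 ⟨_, ha, rfl⟩) (ev _ _ hl) hk hb (ev _ _ hr), ?_⟩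
    exact h.update_local (by rw [h.mem]) h.nalloc 1
  | alloc ha hl hk hb hr hok =>
    obtain ⟨rfl, rfl⟩ := hc.eq_of_at hP ha
    refine ⟨_, .alloc ((hc.at_iff hP hK).2 ⟨_, ha, rfl⟩) (ev _ _ hl) hk hb (ev _ _ hr)
      (h.nalloc ▸ hok), ?_⟩
    exact h.update_local (by rw [h.mem, h.nalloc]) (by rw [h.nalloc]) 1
  | @call m f fid es vs m' f' ha hvs hf' hfid hlen hfit =>
    obtain ⟨rfl, rfl⟩ := hc.eq_of_at hP ha
    subst hfid
    refine ⟨_, .call ((hc.at_iff hP hK).2 ⟨_, ha, rfl⟩) ((h.eval_list_iff hP hc _ _).2 hvs)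
      (hasFun_compile.2 ⟨m', f', hf', rfl, rfl⟩) rfl hlen (h.mstc m' hf'.1) ?_, ?_⟩
    · simp only [Cap.addr]
      change _ + (f'.frameSize : ℤ) ≤ _
      omega
    · rw [h.mem]
      exact h.call hP hf' hfit _
  | @ret m f r stk' ha hstk =>
    obtain ⟨rfl, rfl⟩ := hc.eq_of_at hP ha
    have hst := h.stk
    rw [hstk] at hst
    cases ht : t.stk with
    | nil => rw [ht] at hst; cases hst
    | cons b tstk' =>
    rw [ht, List.forall₂_cons] at hst
    obtain ⟨⟨m', hr⟩, -⟩ := hst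
    have hr' := hr
    obtain ⟨f', hf', -, -, hpcc'⟩ := hr'
    obtain ⟨stc', hstc'⟩ : ∃ stc', Function.update t.mstc m.mid
        (some ((m.stackCap s.Φ).inc (-(f.frameSize : ℤ)))) m'.mid = some stc' := by
      by_cases he : m'.mid = m.mid
      · rw [he, Function.update_self]
        exact ⟨_, rfl⟩
      · rw [Function.update_of_ne he]
        exact ⟨_, h.mstc m' hf'.1⟩
    refine ⟨_, .ret (m := compileMod K m) (f := compileFun K m f) (m' := compileMod K m')
      (f' := compileFun K m' f') ((hc.at_iff hP hK).2 ⟨_, ha, rfl⟩) ?_ ht ?_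
      (h.mstc m hc.hasFun.1) rfl hstc', h.ret hP hc hstk ht hr hstc'⟩
    · rw [hc.pcc]
      exact (owner_compile_iff hP hK hc.hasFun).2 ⟨rfl, rfl⟩
    · rw [hpcc']
      exact (owner_compile_iff hP hK hf').2 ⟨rfl, rfl⟩
  | jumpZero ha he ho =>
    obtain ⟨rfl, rfl⟩ := hc.eq_of_at hP ha
    refine ⟨_, .jumpZero ((hc.at_iff hP hK).2 ⟨_, ha, rfl⟩) (ev _ _ he) (ev _ _ ho), ?_⟩
    exact h.update_local h.mem h.nalloc _
  | jumpNonzero ha he hv =>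
    obtain ⟨rfl, rfl⟩ := hc.eq_of_at hP ha
    refine ⟨_, .jumpNonzero ((hc.at_iff hP hK).2 ⟨_, ha, rfl⟩) (ev _ _ he) hv, ?_⟩
    exact h.update_local h.mem h.nalloc 1

theorem CrossRel.step_backward (hP : P.Executable) (hK : CodeLayout K P) (h : CrossRel K P s t)
    {t' : TState} (ht : TStep (compile K P) limit t t') :
    ∃ s', SStep P limit s s' ∧ CrossRel K P s' t' := by
  obtain ⟨m, f, hc⟩ := h.exists_controlAt
  have ev := fun e v => (h.eval_iff hP hc e v).1
  cases ht with
  | assign hta hl hk hb hr =>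
    obtain ⟨c, ha, he⟩ := (hc.at_iff hP hK).1 hta
    cases c <;> cases he
    exact ⟨_, .assign ha (ev _ _ hl) hk hb (ev _ _ hr),
      h.update_local (by rw [h.mem]) h.nalloc 1⟩
  | alloc hta hl hk hb hr hok =>
    obtain ⟨c, ha, he⟩ := (hc.at_iff hP hK).1 hta
    cases c <;> cases he
    exact ⟨_, .alloc ha (ev _ _ hl) hk hb (ev _ _ hr) (h.nalloc ▸ hok),
      h.update_local (by rw [h.mem, h.nalloc]) (by rw [h.nalloc]) 1⟩
  | call hta hvs htf hfid hlen hsc hfit =>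
    obtain ⟨c, ha, he⟩ := (hc.at_iff hP hK).1 hta
    cases c <;> cases he
    obtain ⟨m', f', hf', rfl, rfl⟩ := hasFun_compile.1 htf
    cases hfid
    have hsc' := (h.mstc m' hf'.1).symm.trans hsc
    cases hsc'
    -- The fitting check of the target is about the addresses, that of the source about sizes.
    have hfit' : s.Φ m'.mid + f'.frameSize ≤ m'.stack.2 - m'.stack.1 := by
      simp only [Cap.addr] at hfit
      change _ + (f'.frameSize : ℤ) ≤ _ at hfit
      omega
    refine ⟨_, .call ha ((h.eval_list_iff hP hc _ _).1 hvs) hf' rfl hlen hfit', ?_⟩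
    rw [h.mem]
    exact h.call hP hf' hfit' _
  | ret hta ho hstk ho' hsc hmstc hstc =>
    obtain ⟨c, ha, he⟩ := (hc.at_iff hP hK).1 hta
    cases c <;> cases he
    rw [hc.pcc] at ho
    obtain ⟨rfl, rfl⟩ := (owner_compile_iff hP hK hc.hasFun).1 ho
    have hsc' := (h.mstc m hc.hasFun.1).symm.trans hsc
    cases hsc'
    subst hmstc
    have hst := h.stk
    rw [hstk] at hst
    cases hs : s.stk with
    | nil => rw [hs] at hst; cases hst
    | cons r stk' =>
    rw [hs, List.forall₂_cons] at hst
    obtain ⟨⟨m', hr⟩, -⟩ := hst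
    have hr' := hr
    obtain ⟨f', hf', -, -, hpcc'⟩ := hr'
    dsimp only at hr hpcc'
    rw [hpcc'] at ho'
    obtain ⟨rfl, rfl⟩ := (owner_compile_iff hP hK hf').1 ho'
    exact ⟨_, .ret ha hs, h.ret hP hc hs hstk hr hstc⟩
  | jumpZero hta he ho =>
    obtain ⟨c, ha, hcmd⟩ := (hc.at_iff hP hK).1 hta
    cases c <;> cases hcmd
    exact ⟨_, .jumpZero ha (ev _ _ he) (ev _ _ ho), h.update_local h.mem h.nalloc _⟩
  | jumpNonzero hta he hv =>
    obtain ⟨c, ha, hcmd⟩ := (hc.at_iff hP hK).1 hta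
    cases c <;> cases hcmd
    exact ⟨_, .jumpNonzero ha (ev _ _ he) hv, h.update_local h.mem h.nalloc 1⟩

end States

/-! ### Simulation of traces -/

section Traces

variable {K : FunID → ℤ} {C p : SProg} {limit : ℕ} {s : SState} {t : TState}

/-- The code of a function is in the code memory of the part `p` only if the function belongs to
`p`, since the functions of the whole program are at disjoint places. -/
theorem CrossRel.inside_iff (hP : SProg.Executable (C ++ p)) (hK : CodeLayout K (C ++ p))
    (h : CrossRel K (C ++ p) s t) : t.Inside (compile K p) ↔ s.Inside p := by
  obtain ⟨m, f, hc⟩ := h.exists_controlAt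
  have hr : t.pcc.range = Set.Ico (K f.fid) (K f.fid + f.body.length) := by
    rw [hc.pcc]
    simp [Cap.range, Cap.inc, TFun.codeCap, compileFun]
  have hsub : ∀ {m' f'}, p.HasFun m' f' → SProg.HasFun (C ++ p) m' f' :=
    fun h => ⟨List.mem_append_right _ h.1, h.2⟩
  rw [TState.Inside, hr]
  constructor
  · intro hin
    have hb := hP.body_pos hc.hasFun
    obtain ⟨c, hcm⟩ := Option.isSome_iff_exists.1 (hin (a := K f.fid) ⟨le_rfl, by omega⟩)
    obtain ⟨g, hg, ha, -⟩ := TProg.mem_range_of_codeMem hcm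
    obtain ⟨m', f', h', rfl⟩ := mem_allFuns_compile.1 hg
    obtain ⟨-, rfl⟩ := hK.unique hP hc.hasFun (hsub h') (a := K f.fid) ⟨le_rfl, by omega⟩
      (by simpa [compileFun] using ha)
    exact ⟨f, h'.mem_allFuns, hc.fid⟩
  · rintro ⟨f', hf', hfid⟩ a ha
    obtain ⟨m', h'⟩ := SProg.mem_allFuns.1 hf'
    obtain ⟨rfl, rfl⟩ := hP.hasFun_unique hc.hasFun (hsub h') (hc.fid.trans hfid.symm)
    exact TProg.codeMem_isSome (mem_allFuns_compile.2 ⟨m, f, h', rfl⟩)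
      (by simpa [compileFun] using ha)

theorem CrossRel.trace_forward (hP : SProg.Executable (C ++ p)) (hK : CodeLayout K (C ++ p))
    (h : CrossRel K (C ++ p) s t) {s' : SState} {ς ς' : Set ℤ} {l : Label}
    (hs : STrace (C ++ p) limit p (s, ς) l (s', ς')) :
    ∃ t', TTrace (compile K (C ++ p)) limit (compile K p) (t, ς) l (t', ς') ∧
      CrossRel K (C ++ p) s' t' := by
  obtain ⟨m, f, hc⟩ := h.exists_controlAt
  have hi := h.inside_iff hP hK
  cases hs with
  | silent hs hin =>
    obtain ⟨t', ht, h'⟩ := h.step_forward hP hK hs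
    exact ⟨t', .silent ht (by rwa [hi, h'.inside_iff hP hK]), h'⟩
  | tick hs =>
    obtain ⟨m', f', ha⟩ := hs
    obtain ⟨rfl, rfl⟩ := hc.eq_of_at hP ha
    exact ⟨t, .tick ((hc.at_iff hP hK).2 ⟨_, ha, rfl⟩), h⟩
  | ret hs ha hd hς =>
    obtain ⟨rfl, rfl⟩ := hc.eq_of_at hP ha
    obtain ⟨t', ht, h'⟩ := h.step_forward hP hK hs
    rw [← h'.mem] at hς
    rw [← h'.mem, ← h.nalloc]
    exact ⟨t', .ret ht ((hc.at_iff hP hK).2 ⟨_, ha, rfl⟩) (by rwa [hi, h'.inside_iff hP hK]) hς, h'⟩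
  | call hs ha hd hvs hς =>
    obtain ⟨rfl, rfl⟩ := hc.eq_of_at hP ha
    obtain ⟨t', ht, h'⟩ := h.step_forward hP hK hs
    rw [← h'.mem] at hς
    rw [← h'.mem, ← h.nalloc]
    exact ⟨t', .call ht ((hc.at_iff hP hK).2 ⟨_, ha, rfl⟩) (by rwa [hi, h'.inside_iff hP hK])
      ((h.eval_list_iff hP hc _ _).2 hvs) hς, h'⟩

theorem CrossRel.trace_backward (hP : SProg.Executable (C ++ p)) (hK : CodeLayout K (C ++ p))
    (h : CrossRel K (C ++ p) s t) {t' : TState} {ς ς' : Set ℤ} {l : Label}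
    (ht : TTrace (compile K (C ++ p)) limit (compile K p) (t, ς) l (t', ς')) :
    ∃ s', STrace (C ++ p) limit p (s, ς) l (s', ς') ∧ CrossRel K (C ++ p) s' t' := by
  obtain ⟨m, f, hc⟩ := h.exists_controlAt
  have hi := h.inside_iff hP hK
  cases ht with
  | silent ht hin =>
    obtain ⟨s', hs, h'⟩ := h.step_backward hP hK ht
    exact ⟨s', .silent hs (by rwa [hi, h'.inside_iff hP hK] at hin), h'⟩
  | tick ht =>
    obtain ⟨c, ha, he⟩ := (hc.at_iff hP hK).1 ht
    cases c <;> cases he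
    exact ⟨s, .tick ⟨m, f, ha⟩, h⟩
  | ret ht hta hd hς =>
    obtain ⟨c, ha, he⟩ := (hc.at_iff hP hK).1 hta
    cases c <;> cases he
    obtain ⟨s', hs, h'⟩ := h.step_backward hP hK ht
    rw [h'.mem] at hς
    rw [h'.mem, h.nalloc]
    exact ⟨s', .ret hs ha (by rwa [hi, h'.inside_iff hP hK] at hd) hς, h'⟩
  | call ht hta hd hvs hς =>
    obtain ⟨c, ha, he⟩ := (hc.at_iff hP hK).1 hta
    cases c <;> cases he
    obtain ⟨s', hs, h'⟩ := h.step_backward hP hK ht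
    rw [h'.mem] at hς
    rw [h'.mem, h.nalloc]
    exact ⟨s', .call hs ha (by rwa [hi, h'.inside_iff hP hK] at hd)
      ((h.eval_list_iff hP hc _ _).1 hvs) hς, h'⟩

/-- A step-by-step simulation, with equal labels, lifts to compressed steps. -/
theorem Compressed.simulate {S T : Type} {R : S → Label → S → Prop} {R' : T → Label → T → Prop}
    {Rel : S → T → Prop}
    (hsim : ∀ {x y x' l}, Rel x y → R x l x' → ∃ y', R' y l y' ∧ Rel x' y')
    {x x' : S} {α : List Label} (hx : Compressed R x α x') {y : T} (h : Rel x y) :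
    ∃ y', Compressed R' y α y' ∧ Rel x' y' := by
  induction hx generalizing y with
  | nil => exact ⟨y, .nil y, h⟩
  | tau hR _ ih =>
    obtain ⟨y₁, h₁, hr⟩ := hsim h hR
    obtain ⟨y', h', hr'⟩ := ih hr
    exact ⟨y', .tau h₁ h', hr'⟩
  | cons hl hR _ ih =>
    obtain ⟨y₁, h₁, hr⟩ := hsim h hR
    obtain ⟨y', h', hr'⟩ := ih hr
    exact ⟨y', .cons hl h₁ h', hr'⟩

theorem CrossRel.compressed_forward (hP : SProg.Executable (C ++ p)) (hK : CodeLayout K (C ++ p))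
    (h : CrossRel K (C ++ p) s t) {s' : SState} {ς ς' : Set ℤ} {α : List Label}
    (hs : Compressed (STrace (C ++ p) limit p) (s, ς) α (s', ς')) :
    ∃ t', Compressed (TTrace (compile K (C ++ p)) limit (compile K p)) (t, ς) α (t', ς') ∧
      CrossRel K (C ++ p) s' t' := by
  obtain ⟨⟨t', σ⟩, ht, h', rfl⟩ := Compressed.simulate
    (R' := TTrace (compile K (C ++ p)) limit (compile K p))
    (Rel := fun x y => CrossRel K (C ++ p) x.1 y.1 ∧ x.2 = y.2) (y := (t, ς)) (by
      rintro ⟨x, ς₁⟩ ⟨y, ς₂⟩ ⟨x', ς₁'⟩ l ⟨hr, rfl⟩ hR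
      obtain ⟨y', h₁, h₂⟩ := hr.trace_forward hP hK hR
      exact ⟨(y', ς₁'), h₁, h₂, rfl⟩) hs ⟨h, rfl⟩
  exact ⟨t', ht, h'⟩

theorem CrossRel.compressed_backward (hP : SProg.Executable (C ++ p)) (hK : CodeLayout K (C ++ p))
    (h : CrossRel K (C ++ p) s t) {t' : TState} {ς ς' : Set ℤ} {α : List Label}
    (ht : Compressed (TTrace (compile K (C ++ p)) limit (compile K p)) (t, ς) α (t', ς')) :
    ∃ s', Compressed (STrace (C ++ p) limit p) (s, ς) α (s', ς') ∧
      CrossRel K (C ++ p) s' t' := by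
  obtain ⟨⟨s', σ⟩, hs, h', rfl⟩ := Compressed.simulate
    (R' := STrace (C ++ p) limit p)
    (Rel := fun y x => CrossRel K (C ++ p) x.1 y.1 ∧ y.2 = x.2) (y := (s, ς)) (by
      rintro ⟨y, ς₁⟩ ⟨x, ς₂⟩ ⟨y', ς₁'⟩ l ⟨hr, rfl⟩ hR
      obtain ⟨x', h₁, h₂⟩ := hr.trace_backward hP hK hR
      exact ⟨(x', ς₁'), h₁, h₂, rfl⟩) ht ⟨h, rfl⟩
  exact ⟨s', hs, h'⟩

end Traces

/-! ### Compiled programs and initial states -/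

section Init

variable {K : FunID → ℤ} {P : SProg}

theorem allFuns_compile (K : FunID → ℤ) (P : SProg) :
    (compile K P).allFuns = P.flatMap fun m => m.funs.map (compileFun K m) := by
  simp [TProg.allFuns, compile, compileMod, List.flatMap_map]

theorem segments_compile (K : FunID → ℤ) (P : SProg) :
    (compile K P).segments = P.segments := by
  simp [TProg.segments, SProg.segments, compile, compileMod, List.flatMap_map]

/-- Properties that depend only on the names and lengths of the functions transfer to the
compiled program through this list. -/
theorem map_allFuns_compile (K : FunID → ℤ) (P : SProg) :
    (compile K P).allFuns.map (fun g => (g.fid, g.start, g.body.length)) =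
      P.allFuns.map fun f => (f.fid, K f.fid, f.body.length) := by
  simp [allFuns_compile, SProg.allFuns, List.map_flatMap, Function.comp_def, compileFun]

theorem compile_executable (hP : P.Executable) (hK : CodeLayout K P) :
    (compile K P).Executable where
  mids := by
    have := hP.mids
    rwa [compile, List.map_map]
  fids := by
    have h := congrArg (List.map Prod.fst) (map_allFuns_compile K P)
    simp only [List.map_map, Function.comp_def] at h
    rw [h]
    exact hP.fids
  segs := by
    rw [segments_compile]
    exact hP.segs
  body_ne := by
    intro f' hf'
    obtain ⟨m, f, hf, rfl⟩ := mem_allFuns_compile.1 hf'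
    simpa [compileFun] using (hP.fun_wf hf).body_ne
  code := by
    have h : (P.allFuns.map fun f => (f.fid, K f.fid, f.body.length)).Pairwise
        fun a b => Disjoint (Set.Ico a.2.1 (a.2.1 + (a.2.2 : ℤ)))
          (Set.Ico b.2.1 (b.2.1 + (b.2.2 : ℤ))) := List.pairwise_map.2 hK
    rw [← map_allFuns_compile, List.pairwise_map] at h
    exact h
  whole := by
    intro f' hf' fid es hcall
    obtain ⟨m, f, hf, rfl⟩ := mem_allFuns_compile.1 hf'
    obtain ⟨c, hc, he⟩ := List.mem_map.1 hcall
    cases c <;> cases he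
    obtain ⟨g, hg, rfl⟩ := hP.whole f hf.mem_allFuns _ _ hc
    obtain ⟨m', hg⟩ := SProg.mem_allFuns.1 hg
    exact ⟨compileFun K m' g, mem_allFuns_compile.2 ⟨m', g, hg, rfl⟩, rfl⟩
  main := by
    obtain ⟨m, f, hf, hfid, hargs, hfit⟩ := hP.main
    exact ⟨_, _, hasFun_compile.2 ⟨m, f, hf, rfl, rfl⟩, hfid, by simp [compileFun, hargs], hfit⟩

theorem SProg.Executable.stack_nonneg (hP : P.Executable) {m : SMod} (hm : m ∈ P) :
    m.stack.1 ≤ m.stack.2 :=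
  (hP.segs.1 m.stack (List.mem_flatMap.2 ⟨m, hm, by simp⟩)).2

/-- The function `main` and its module are unique, so every initial state has the frame of `main`,
which fits in the stack of its module, as the only live frame. -/
theorem SInit.exists_crossRel (hP : P.Executable) (K : FunID → ℤ) {s : SState} (hs : SInit P s) :
    ∃ t, TInit (compile K P) t ∧ CrossRel K P s t := by
  obtain ⟨m, f, hf, hfid, rfl⟩ := hs
  have hfind : ∀ m₁ ∈ P, (compile K P).find? (fun m' => m'.mid == m₁.mid) =
      some (compileMod K m₁) := by
    intro m₁ hm₁
    cases h : (compile K P).find? fun m' => m'.mid == m₁.mid with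
    | none =>
      have := List.find?_eq_none.1 h (compileMod K m₁) (List.mem_map_of_mem hm₁)
      simp [compileMod] at this
    | some g =>
      obtain ⟨m₂, hm₂, rfl⟩ := List.mem_map.1 (List.mem_of_find?_eq_some h)
      have he := List.find?_some h
      rw [hP.mod_unique hm₂ hm₁ (by simpa [compileMod] using he)]
  refine ⟨_, ⟨compileMod K m, compileFun K m f, hasFun_compile.2 ⟨m, f, hf, rfl, rfl⟩, hfid, rfl⟩,
    ?_, rfl, ?_, .nil, ?_, ?_⟩
  · rw [segments_compile]
  · refine ⟨m, ⟨f, hf, hfid, rfl, by simp [Cap.inc]⟩, ?_⟩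
    simp only [hfind m hf.1]
    simp [compileMod]
  · intro m₁ hm₁
    simp only [hfind m₁ hm₁]
    simp [compileMod, compileFun, SFun.frameSize, TFun.frameSize]
  · intro m₁ hm₁
    have h₀ := hP.stack_nonneg hm₁
    simp only [List.map_nil, List.map_cons, List.sum_cons, List.sum_nil, add_zero]
    rw [← hfid]
    by_cases he : m₁ = m
    · subst he
      obtain ⟨m', f', hf', hfid', -, hfit⟩ := hP.main
      obtain ⟨rfl, rfl⟩ := hP.hasFun_unique hf hf' (hfid.trans hfid'.symm)
      rw [if_pos rfl, hP.frameOf_self hf]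
      exact ⟨rfl, hfit⟩
    · have hne : m₁.mid ≠ m.mid := fun e => he (hP.mod_unique hm₁ hf.1 e)
      rw [if_neg hne, hP.frameOf_of_ne hf hm₁ he]
      exact ⟨rfl, by omega⟩

/-! ### Extension of code layouts -/

theorem compile_congr {K K' : FunID → ℤ} {p : SProg} (h : ∀ f ∈ p.allFuns, K f.fid = K' f.fid) :
    compile K p = compile K' p := by
  refine List.map_congr_left fun m hm => ?_
  simp only [compileMod, TMod.mk.injEq, true_and]
  refine List.map_congr_left fun f hf => ?_
  simp only [compileFun, h f (SProg.mem_allFuns.2 ⟨m, hm, hf⟩)]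

theorem exists_forall_le_of_list {α : Type*} (l : List α) (g : α → ℤ) : ∃ b, ∀ x ∈ l, g x ≤ b := by
  induction l with
  | nil => exact ⟨0, by simp⟩
  | cons x l ih =>
    obtain ⟨b, hb⟩ := ih
    refine ⟨max (g x) b, ?_⟩
    intro y hy
    rcases List.mem_cons.1 hy with rfl | hy
    · exact le_max_left _ _
    · exact (hb y hy).trans (le_max_right _ _)

/-- A code layout of a program extends to every context: the functions of the context are placed
beyond those of the program, in slots of equal size that are numbered by the names. -/
theorem CodeLayout.exists_extension {K : FunID → ℤ} {C p : SProg} (hK : CodeLayout K p)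
    (hP : SProg.Executable (C ++ p)) :
    ∃ K', CodeLayout K' (C ++ p) ∧ ∀ f ∈ p.allFuns, K f.fid = K' f.fid := by
  classical
  -- `B` bounds the code of `p` from above, and `L` the lengths of the functions of `C`.
  obtain ⟨B, hB⟩ := exists_forall_le_of_list p.allFuns fun f => K f.fid + f.body.length
  obtain ⟨L, hL⟩ := exists_forall_le_of_list C.allFuns fun f => (f.body.length : ℤ)
  let K' : FunID → ℤ := fun fid =>
    if ∃ f ∈ p.allFuns, f.fid = fid then K fid else B + fid * max L 0
  have hp : ∀ f ∈ p.allFuns, K' f.fid = K f.fid := fun f hf => if_pos ⟨f, hf, rfl⟩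
  have hall : SProg.allFuns (C ++ p) = C.allFuns ++ p.allFuns := by simp [SProg.allFuns]
  have hn := hP.fids
  rw [hall, List.map_append, List.nodup_append'] at hn
  have hC : ∀ f ∈ C.allFuns, K' f.fid = B + f.fid * max L 0 := by
    refine fun f hf => if_neg ?_
    rintro ⟨g, hg, he⟩
    exact hn.2.2 (List.mem_map_of_mem hf) (he ▸ List.mem_map_of_mem hg)
  refine ⟨K', ?_, fun f hf => (hp f hf).symm⟩
  rw [CodeLayout, hall, List.pairwise_append]
  refine ⟨?_, ?_, ?_⟩
  · refine (List.pairwise_map.1 hn.1).imp_of_mem ?_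
    intro f g hf hg hne
    rw [hC f hf, hC g hg, Set.disjoint_left]
    rintro a ⟨h₁, h₂⟩ ⟨h₃, h₄⟩
    have hLf := (hL f hf).trans (le_max_left L 0)
    have hLg := (hL g hg).trans (le_max_left L 0)
    have hm : 0 ≤ max L 0 := le_max_right _ _
    rcases Nat.lt_or_gt_of_ne hne with h | h
    · have : ((f.fid : ℤ) + 1) * max L 0 ≤ g.fid * max L 0 :=
        mul_le_mul_of_nonneg_right (by exact_mod_cast h) hm
      linarith
    · have : ((g.fid : ℤ) + 1) * max L 0 ≤ f.fid * max L 0 :=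
        mul_le_mul_of_nonneg_right (by exact_mod_cast h) hm
      linarith
  · refine List.Pairwise.imp_of_mem ?_ hK
    intro f g hf hg h
    rwa [hp f hf, hp g hg]
  · intro f hf g hg
    rw [hC f hf, hp g hg, Set.disjoint_left]
    rintro a ⟨h₁, -⟩ ⟨-, h₄⟩
    have hBg := hB g hg
    have : 0 ≤ (f.fid : ℤ) * max L 0 := mul_nonneg (Int.natCast_nonneg _) (le_max_right _ _)
    linarith

/-- A source context that exhibits a trace is compiled, for an extended layout, to a target
context that exhibits the same trace. -/
theorem str_subset_ttr_compile (limit : ℕ) {p : SProg} (hK : CodeLayout K p) :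
    STr limit p ⊆ TTr limit (compile K p) := by
  rintro α ⟨C, s₀, s, ς, hP, hs, hα⟩
  obtain ⟨K', hK', he⟩ := hK.exists_extension hP
  obtain ⟨t₀, ht, h⟩ := hs.exists_crossRel hP K'
  obtain ⟨t, hα', -⟩ := h.compressed_forward hP hK' hα
  have hx := compile_executable hP hK'
  have happ : compile K' (C ++ p) = compile K' C ++ compile K' p := List.map_append
  rw [happ] at ht hx hα'
  rw [compile_congr he]
  exact ⟨compile K' C, t₀, t, ς, hx, ht, hα'⟩

end Init

end PAC

open PAC in
theorem mainTheorem7 (limit : ℕ) :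
    -- forward simulation
    (∀ (C p : SProg) (K : FunID → ℤ), SProg.Executable (C ++ p) → CodeLayout K (C ++ p) →
      ∀ (s s' : SState) (t : TState) (ς ς' : Set ℤ) (α : List Label),
        CrossRel K (C ++ p) s t →
        Compressed (STrace (C ++ p) limit p) (s, ς) α (s', ς') →
        ∃ t' : TState,
          Compressed (TTrace (compile K (C ++ p)) limit (compile K p)) (t, ς) α (t', ς') ∧
          CrossRel K (C ++ p) s' t') ∧
    -- backward simulation
    (∀ (C p : SProg) (K : FunID → ℤ), SProg.Executable (C ++ p) → CodeLayout K (C ++ p) →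
      ∀ (s : SState) (t t' : TState) (ς ς' : Set ℤ) (α : List Label),
        CrossRel K (C ++ p) s t →
        Compressed (TTrace (compile K (C ++ p)) limit (compile K p)) (t, ς) α (t', ς') →
        ∃ s' : SState,
          Compressed (STrace (C ++ p) limit p) (s, ς) α (s', ς') ∧
          CrossRel K (C ++ p) s' t') ∧
    -- initial states exist, and are related
    (∀ (P : SProg) (K : FunID → ℤ), P.Executable → CodeLayout K P →
      (compile K P).Executable ∧
      ∃ (s : SState) (t : TState), SInit P s ∧ TInit (compile K P) t ∧ CrossRel K P s t) ∧
    -- no trace is omitted by compilation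
    (∀ (p : SProg) (K : FunID → ℤ), CodeLayout K p →
      STr limit p ⊆ TTr limit (compile K p)) := by
  refine ⟨fun C p K hP hK s s' t ς ς' α h hs => h.compressed_forward hP hK hs,
    fun C p K hP hK s t t' ς ς' α h ht => h.compressed_backward hP hK ht, ?_,
    fun p K hK => str_subset_ttr_compile limit hK⟩
  intro P K hP hK
  obtain ⟨m, f, hf, hfid, -, -⟩ := hP.main
  have hs : SInit P _ := ⟨m, f, hf, hfid, rfl⟩
  obtain ⟨t, ht, h⟩ := hs.exists_crossRel hP K
  exact ⟨compile_executable hP hK, _, t, hs, ht, h⟩
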